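/- Let $k\in\mathbb C$ and let $p_0$ be a formal variable. **Laurent CMS integrals.** Let $\Lambda^{\pm}[p_0]$ be the polynomial algebra over $\mathbb C[p_0]$ in free generators $p_a$, $a\in\mathbb Z\setminus\{0\}$, and $\Lambda[p_0]\subset\Lambda^\pm[p_0]$ (resp. $\Lambda$) the subalgebra generated over $\mathbb C[p_0]$ (resp. over $\mathbb C$) by the $p_a$ with $a>0$. On $\Lambda^{\pm}[p_0][x,x^{-1}]$ let $\partial$ be the $\mathbb C[p_0]$-linear derivation with $\partial x=x$, $\partial p_a=a x^a$; let $\Delta_{p_0}$ be the $\Lambda^\pm[p_0]$-linear operator with $\Delta_{p_0}(1)=0$, $$\Delta_{p_0}(x^l)=x^lp_0+2x^{l-1}p_1+\dots+2xp_{l-1}+p_l-2lx^l,\qquad \Delta_{p_0}(x^{-l})=-(\Delta_{p_0}(x^{l}))^*\qquad(l>0),$$ where $*$ is the $\mathbb C[p_0]$-linear algebra involution $p_a\mapsto p_{-a}$, $x\mapsto x^{-1}$; let $D_{k,p_0}=\partial-\frac k2\Delta_{p_0}$, and let $E_{p_0}:\Lambda^{\pm}[p_0][x,x^{-1}]\to\Lambda^\pm[p_0]$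 be the $\Lambda^\pm[p_0]$-linear map $x^l\mapsto p_l$ ($l\in\mathbb Z$). The Laurent CMS integrals are $\mathcal L^{(r)}_{k,p_0}=E_{p_0}\circ D_{k,p_0}^r|_{\Lambda^\pm[p_0]}$, $r\ge0$. They preserve $\Lambda[p_0]$; let $\mathcal D_L(k,p_0)\subset \mathrm{End}_{\mathbb C[p_0]}(\Lambda[p_0])$ be the algebra generated over $\mathbb C[p_0]$ by their restrictions to $\Lambda[p_0]$. **Stable CMS integrals.** Let $\Lambda_N=\mathbb C[x_1,\dots,x_N]^{S_N}$, $$D_{i,N}=x_i\frac{\partial}{\partial x_i}-\frac k2\sum_{j\ne i}\frac{x_i+x_j}{x_i-x_j}(1-s_{ij}),\qquad \mathcal L^{(r)}_{k,N}=\Bigl(\sum_{i=1}^N D_{i,N}^r\Bigr)\Big|_{\Lambda_N},$$ where $s_{ij}$ swaps $x_i$ and $x_j$, and let $\mathcal D_N(k)\subset\mathrm{End}_{\mathbb C}(\Lambda_N)$ be the algebra generated over $\mathbb C$ by the $\mathcal L^{(r)}_{k,N}$, $r\ge 0$. Let $\mathcal D(k)=\varprojlim\mathcal D_N(k)$ be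 the inverse limit, in the category of algebras filtered by the order of differential operators, with respect to the maps induced by $\Lambda_{N+1}\to\Lambda_N$, $x_{N+1}\mapsto0$: its elements are the sequences $(S_N)_N$, $S_N\in\mathcal D_N(k)$, compatible with these maps and of uniformly bounded order. Let $\varphi_N:\Lambda\to\Lambda_N$ be the homomorphism $p_a\mapsto x_1^a+\dots+x_N^a$. **Theorem.** The algebra $\mathcal D(k)$ is isomorphic to the algebra of those operators $D$ on $\Lambda$ for which there is $(S_N)\in\mathcal D(k)$ with $\varphi_N\circ D=S_N\circ\varphi_N$ for all $N$; the isomorphism sends $(S_N)$ to such a $D$. With $\mathcal D(k)$ regarded in this way as an algebra of operators on $\Lambda$, the natural homomorphism $\mathbb C[p_0]\otimes\mathcal D(k)\to\mathrm{End}_{\mathbb C[p_0]}(\Lambda[p_0])$ is injective, and its image $\mathcal D(k)[p_0]$ equals $\mathcal D_L(k,p_0)$: $$\mathcal D_L(k,p_0)=\mathcal D(k)[p_0].$$ -/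

import Mathlib

open scoped TensorProduct

noncomputable section

namespace CMS

/-! ### Differential operators of bounded order -/

/-- Grothendieck's differential operators: `D` has order at most `0` if it commutes with all
multiplications, and order at most `m + 1` if all commutators `[D, f]` have order at most `m`. -/
def IsDiffOp {A : Type*} [CommRing A] [Algebra ℂ A] : ℕ → Module.End ℂ A → Prop
  | 0, D => ∀ f : A, D * LinearMap.mulLeft ℂ f = LinearMap.mulLeft ℂ f * D
  | m + 1, D => ∀ f : A, IsDiffOp m (D * LinearMap.mulLeft ℂ f - LinearMap.mulLeft ℂ f * D)

section DiffOp

variable {A : Type*} [CommRing A] [Algebra ℂ A]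

theorem IsDiffOp.zero (m : ℕ) : IsDiffOp m (0 : Module.End ℂ A) := by
  induction m with
  | zero => intro f; simp
  | succ m ih => intro f; simpa using ih

theorem IsDiffOp.succ {m : ℕ} {D : Module.End ℂ A} (h : IsDiffOp m D) : IsDiffOp (m + 1) D := by
  induction m generalizing D with
  | zero => intro f; rw [h f, sub_self]; exact IsDiffOp.zero 0
  | succ m ih => intro f; exact ih (h f)

theorem IsDiffOp.mono {m n : ℕ} (hmn : m ≤ n) {D : Module.End ℂ A} (h : IsDiffOp m D) :
    IsDiffOp n D := by
  induction hmn with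
  | refl => exact h
  | step _ ih => exact ih.succ

theorem IsDiffOp.add {m : ℕ} {D E : Module.End ℂ A} (hD : IsDiffOp m D) (hE : IsDiffOp m E) :
    IsDiffOp m (D + E) := by
  induction m generalizing D E with
  | zero => intro f; rw [add_mul, mul_add, hD f, hE f]
  | succ m ih =>
    intro f
    have := ih (hD f) (hE f)
    convert this using 1
    noncomm_ring

theorem isDiffOp_algebraMap (m : ℕ) (c : ℂ) :
    IsDiffOp m (algebraMap ℂ (Module.End ℂ A) c) :=
  IsDiffOp.mono (Nat.zero_le m) fun _ => Algebra.commutes _ _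

theorem IsDiffOp.mul {m n : ℕ} {D E : Module.End ℂ A} (hD : IsDiffOp m D) (hE : IsDiffOp n E) :
    IsDiffOp (m + n) (D * E) := by
  induction hs : m + n generalizing m n D E with
  | zero =>
    obtain ⟨rfl, rfl⟩ : m = 0 ∧ n = 0 := by omega
    intro f
    rw [mul_assoc, hE f, ← mul_assoc, hD f, mul_assoc]
  | succ s ih =>
    intro f
    have key : D * E * LinearMap.mulLeft ℂ f - LinearMap.mulLeft ℂ f * (D * E) =
        D * (E * LinearMap.mulLeft ℂ f - LinearMap.mulLeft ℂ f * E) +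
          (D * LinearMap.mulLeft ℂ f - LinearMap.mulLeft ℂ f * D) * E := by
      simp only [mul_sub, sub_mul, mul_assoc]
      abel
    rw [key]
    refine IsDiffOp.add ?_ ?_
    · cases n with
      | zero => rw [hE f, sub_self, mul_zero]; exact IsDiffOp.zero s
      | succ n => exact ih hD (hE f) (by omega)
    · cases m with
      | zero => rw [hD f, sub_self, zero_mul]; exact IsDiffOp.zero s
      | succ m => exact ih (hD f) hE (by omega)

end DiffOp

/-! ### Finitely many variables: Dunkl–Heckman operators and CMS integrals -/

/-- The polynomial algebra `ℂ[x₁, …, x_N]`. -/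
abbrev Poly (N : ℕ) : Type := MvPolynomial (Fin N) ℂ

/-- The algebra `Λ_N` of symmetric polynomials in `N` variables. -/
abbrev SymN (N : ℕ) : Type := MvPolynomial.symmetricSubalgebra (Fin N) ℂ

/-- The action of a permutation of the variables. -/
def permVar {N : ℕ} (e : Equiv.Perm (Fin N)) : Poly N →ₐ[ℂ] Poly N := MvPolynomial.rename e

theorem sub_dvd_sub_swap {N : ℕ} (i j : Fin N) (f : Poly N) :
    (MvPolynomial.X i - MvPolynomial.X j : Poly N) ∣ f - permVar (Equiv.swap i j) f := by
  induction f using MvPolynomial.induction_on with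
  | C a => simp [permVar]
  | add p q hp hq =>
    rw [map_add, add_sub_add_comm]
    exact dvd_add hp hq
  | mul_X p l hp =>
    have h : p * MvPolynomial.X l - permVar (Equiv.swap i j) (p * MvPolynomial.X l) =
        (p - permVar (Equiv.swap i j) p) * MvPolynomial.X l +
          permVar (Equiv.swap i j) p *
            (MvPolynomial.X l - MvPolynomial.X (Equiv.swap i j l)) := by
      rw [map_mul]
      simp only [permVar, MvPolynomial.rename_X]
      ring
    rw [h]
    refine dvd_add (Dvd.dvd.mul_right hp _) (Dvd.dvd.mul_left ?_ _)
    rcases eq_or_ne l i with rfl | hi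
    · rw [Equiv.swap_apply_left]
    · rcases eq_or_ne l j with rfl | hj
      · rw [Equiv.swap_apply_right, ← neg_sub]
        exact Dvd.intro (-1) (by ring)
      · rw [Equiv.swap_apply_of_ne_of_ne hi hj, sub_self]
        exact dvd_zero _

theorem X_sub_X_ne_zero {N : ℕ} {i j : Fin N} (h : i ≠ j) :
    (MvPolynomial.X i - MvPolynomial.X j : Poly N) ≠ 0 := fun h0 =>
  h (MvPolynomial.X_injective (sub_eq_zero.1 h0))

/-- For `i ≠ j` the polynomial `(f - s_{ij} f) / (x_i - x_j)`. -/
def divDiff {N : ℕ} (i j : Fin N) (f : Poly N) : Poly N := (sub_dvd_sub_swap i j f).choose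

theorem divDiff_spec {N : ℕ} (i j : Fin N) (f : Poly N) :
    f - permVar (Equiv.swap i j) f =
      (MvPolynomial.X i - MvPolynomial.X j) * divDiff i j f :=
  (sub_dvd_sub_swap i j f).choose_spec

theorem divDiff_unique {N : ℕ} {i j : Fin N} (h : i ≠ j) {f g : Poly N}
    (hg : f - permVar (Equiv.swap i j) f = (MvPolynomial.X i - MvPolynomial.X j) * g) :
    divDiff i j f = g :=
  mul_left_cancel₀ (X_sub_X_ne_zero h) ((divDiff_spec i j f).symm.trans hg)

/-- The operator `((x_i + x_j) / (x_i - x_j)) (1 - s_{ij})` for `i ≠ j`. -/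
def deltaPair {N : ℕ} (i j : Fin N) (h : i ≠ j) : Module.End ℂ (Poly N) where
  toFun f := (MvPolynomial.X i + MvPolynomial.X j) * divDiff i j f
  map_add' f g := by
    rw [← mul_add]
    congr 1
    refine divDiff_unique h ?_
    rw [mul_add, ← divDiff_spec, ← divDiff_spec, map_add]
    ring
  map_smul' c f := by
    rw [RingHom.id_apply, ← mul_smul_comm]
    congr 1
    refine divDiff_unique h ?_
    rw [mul_smul_comm, ← divDiff_spec, map_smul, smul_sub]

/-- The operator `∂_i = x_i ∂/∂x_i`. -/
def eulerOp {N : ℕ} (i : Fin N) : Module.End ℂ (Poly N) :=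
  LinearMap.mulLeft ℂ (MvPolynomial.X i) * (MvPolynomial.pderiv i).toLinearMap

/-- The Dunkl–Heckman operator
`D_{i,N} = ∂_i - (k/2) ∑_{j ≠ i} ((x_i + x_j) / (x_i - x_j)) (1 - s_{ij})`. -/
def dunklHeckman (k : ℂ) {N : ℕ} (i : Fin N) : Module.End ℂ (Poly N) :=
  eulerOp i - (k / 2) • ∑ j : {j : Fin N // i ≠ j}, deltaPair i j.1 j.2

theorem permVar_divDiff {N : ℕ} (e : Equiv.Perm (Fin N)) {i j : Fin N} (h : i ≠ j) (f : Poly N) :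
    divDiff (e i) (e j) (permVar e f) = permVar e (divDiff i j f) := by
  refine divDiff_unique (fun h' => h (e.injective h')) ?_
  have h1 : (MvPolynomial.X (e i) - MvPolynomial.X (e j) : Poly N) =
      permVar e (MvPolynomial.X i - MvPolynomial.X j) := by simp [permVar]
  rw [h1, ← map_mul, ← divDiff_spec, map_sub]
  congr 1
  simp only [permVar, MvPolynomial.rename_rename]
  congr 2
  funext l
  simp [Function.comp, Equiv.swap_apply_def, e.injective.eq_iff]
  split_ifs <;> rfl

theorem permVar_eulerOp {N : ℕ} (e : Equiv.Perm (Fin N)) (i : Fin N) (f : Poly N) :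
    eulerOp (e i) (permVar e f) = permVar e (eulerOp i f) := by
  simp only [eulerOp, Module.End.mul_apply, LinearMap.mulLeft_apply, Derivation.coeFn_coe, map_mul, permVar, MvPolynomial.rename_X]
  rw [MvPolynomial.pderiv_rename e.injective]

theorem permVar_dunklHeckman (k : ℂ) {N : ℕ} (e : Equiv.Perm (Fin N)) (i : Fin N) (f : Poly N) :
    dunklHeckman k (e i) (permVar e f) = permVar e (dunklHeckman k i f) := by
  simp only [dunklHeckman, LinearMap.sub_apply, LinearMap.smul_apply, LinearMap.sum_apply, map_sub,
    map_smul, map_sum, permVar_eulerOp]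
  congr 2
  symm
  refine Fintype.sum_equiv
    (e.subtypeEquiv fun a => (e.injective.ne_iff (x := i) (y := a)).symm) _ _ fun j => ?_
  simp only [deltaPair, LinearMap.coe_mk, AddHom.coe_mk, Equiv.subtypeEquiv_apply,
    permVar_divDiff e j.2, map_mul, map_add]
  simp [permVar]

theorem permVar_dunklHeckman_pow (k : ℂ) {N : ℕ} (e : Equiv.Perm (Fin N)) (i : Fin N) (r : ℕ)
    (f : Poly N) :
    (dunklHeckman k (e i) ^ r) (permVar e f) = permVar e ((dunklHeckman k i ^ r) f) := by
  induction r with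
  | zero => simp
  | succ r ih => rw [pow_succ', pow_succ', Module.End.mul_apply, Module.End.mul_apply, ih,
      permVar_dunklHeckman]

theorem sum_dunklHeckman_pow_mem (k : ℂ) (N r : ℕ) (f : Poly N)
    (hf : f ∈ MvPolynomial.symmetricSubalgebra (Fin N) ℂ) :
    (∑ i : Fin N, dunklHeckman k i ^ r) f ∈ MvPolynomial.symmetricSubalgebra (Fin N) ℂ := by
  rw [MvPolynomial.mem_symmetricSubalgebra] at hf ⊢
  intro e
  have hfe : permVar e f = f := hf e
  change permVar e _ = _
  rw [LinearMap.sum_apply, map_sum]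
  refine Fintype.sum_equiv e _ _ fun i => ?_
  rw [← permVar_dunklHeckman_pow, hfe]

/-- Heckman's CMS integral `L^{(r)}_{k,N}`: the restriction of `∑_i D_{i,N}^r` to `Λ_N`. -/
def cmsIntegral (k : ℂ) (N r : ℕ) : Module.End ℂ (SymN N) :=
  ((∑ i : Fin N, dunklHeckman k i ^ r).comp
      (MvPolynomial.symmetricSubalgebra (Fin N) ℂ).val.toLinearMap).codRestrict
    (Subalgebra.toSubmodule (MvPolynomial.symmetricSubalgebra (Fin N) ℂ)) fun f => sum_dunklHeckman_pow_mem k N r f.1 f.2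

/-- The algebra `D_N(k)` of quantum CMS integrals, generated by the `L^{(r)}_{k,N}`. -/
def cmsAlgebra (k : ℂ) (N : ℕ) : Subalgebra ℂ (Module.End ℂ (SymN N)) :=
  Algebra.adjoin ℂ (Set.range (cmsIntegral k N))

/-! ### The inverse limit `D(k)` -/

/-- The homomorphism `ℂ[x₁, …, x_{N+1}] → ℂ[x₁, …, x_N]` sending `x_{N+1}` to zero. -/
def killLast (N : ℕ) : Poly (N + 1) →ₐ[ℂ] Poly N :=
  MvPolynomial.aeval (Fin.lastCases 0 fun i : Fin N => (MvPolynomial.X i : Poly N))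

theorem killLast_mem (N : ℕ) (f : SymN (N + 1)) :
    killLast N f.1 ∈ MvPolynomial.symmetricSubalgebra (Fin N) ℂ := by
  rw [MvPolynomial.mem_symmetricSubalgebra]
  intro e
  let e' : Equiv.Perm (Fin (N + 1)) :=
    (finSuccEquivLast (n := N)).trans ((Equiv.optionCongr e).trans (finSuccEquivLast (n := N)).symm)
  have h : (MvPolynomial.rename e).comp (killLast N) =
      (killLast N).comp (MvPolynomial.rename e') := by
    apply MvPolynomial.algHom_ext
    intro i
    refine Fin.lastCases ?_ (fun i => ?_) i <;> simp [killLast, e']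
  have h2 := f.2
  rw [MvPolynomial.mem_symmetricSubalgebra] at h2
  have := DFunLike.congr_fun h f.1
  simp only [AlgHom.comp_apply] at this
  rw [this, h2 e']

/-- The homomorphism `Λ_{N+1} → Λ_N` sending `x_{N+1}` to zero. -/
def symRestrict (N : ℕ) : SymN (N + 1) →ₐ[ℂ] SymN N :=
  ((killLast N).comp (MvPolynomial.symmetricSubalgebra (Fin (N + 1)) ℂ).val).codRestrict
    (MvPolynomial.symmetricSubalgebra (Fin N) ℂ) (killLast_mem N)

/-- The inverse limit of the algebras `D_N(k)`, in the category of algebras filtered by the order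
of differential operators: sequences `(S_N)` with `S_N ∈ D_N(k)`, compatible with the maps
`Λ_{N+1} → Λ_N`, of uniformly bounded order. -/
def stableLimit (k : ℂ) : Subalgebra ℂ ((N : ℕ) → Module.End ℂ (SymN N)) where
  carrier := {S | (∀ N, S N ∈ cmsAlgebra k N) ∧
    (∀ N f, symRestrict N (S (N + 1) f) = S N (symRestrict N f)) ∧
    ∃ m, ∀ N, IsDiffOp m (S N)}
  mul_mem' := by
    rintro S T ⟨hS, hS', m, hm⟩ ⟨hT, hT', n, hn⟩
    refine ⟨fun N => mul_mem (hS N) (hT N), fun N f => ?_, m + n, fun N => (hm N).mul (hn N)⟩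
    simp only [Pi.mul_apply, Module.End.mul_apply, hS', hT']
  add_mem' := by
    rintro S T ⟨hS, hS', m, hm⟩ ⟨hT, hT', n, hn⟩
    refine ⟨fun N => add_mem (hS N) (hT N), fun N f => ?_, max m n, fun N =>
      ((hm N).mono (le_max_left m n)).add ((hn N).mono (le_max_right m n))⟩
    simp only [Pi.add_apply, LinearMap.add_apply, map_add, hS', hT']
  algebraMap_mem' c := by
    refine ⟨fun N => Subalgebra.algebraMap_mem _ c, fun N f => ?_, 0, fun N =>
      isDiffOp_algebraMap 0 c⟩
    simp [Pi.algebraMap_apply, Module.algebraMap_end_apply]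

/-- The algebra `Λ` of symmetric functions, freely generated by the power sums `p_a`, `a > 0`. -/
abbrev Lam : Type := MvPolynomial ℕ+ ℂ

/-- The homomorphism `φ_N : Λ → Λ_N`, `p_a ↦ x₁^a + ⋯ + x_N^a`. -/
def phi (N : ℕ) : Lam →ₐ[ℂ] SymN N :=
  MvPolynomial.aeval fun a : ℕ+ =>
    (⟨MvPolynomial.psum (Fin N) ℂ a, MvPolynomial.psum_isSymmetric (Fin N) ℂ a⟩ : SymN N)

/-- The algebra `D(k)` of stable CMS integrals as an algebra of operators on `Λ`: those operators
on `Λ` which induce an element of the inverse limit of the `D_N(k)`. -/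
def stableOps (k : ℂ) : Subalgebra ℂ (Module.End ℂ Lam) where
  carrier := {D | ∃ S ∈ stableLimit k, ∀ N f, phi N (D f) = S N (phi N f)}
  mul_mem' := by
    rintro D E ⟨S, hS, hDS⟩ ⟨T, hT, hET⟩
    exact ⟨S * T, mul_mem hS hT, fun N f => by simp [hDS, hET]⟩
  add_mem' := by
    rintro D E ⟨S, hS, hDS⟩ ⟨T, hT, hET⟩
    exact ⟨S + T, add_mem hS hT, fun N f => by simp [hDS, hET]⟩
  algebraMap_mem' c :=
    ⟨algebraMap ℂ _ c, Subalgebra.algebraMap_mem _ c, fun N f => by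
      simp [Pi.algebraMap_apply, Module.algebraMap_end_apply]⟩

/-! ### Extension of scalars

Everything below is defined over a commutative `ℂ`-algebra `R` with a chosen element `p₀ : R`. The
case of a formal parameter `p₀` is `R = ℂ[p₀] = Polynomial ℂ`, `p₀ = Polynomial.X`. -/

section Param

variable {R : Type} [CommRing R]

/-- The algebra `Λ_R = R ⊗ Λ`. -/
abbrev LamP (R : Type) [CommRing R] : Type := MvPolynomial ℕ+ R

/-- The `ℂ[p₀]`-linear extension to `Λ[p₀] = ℂ[p₀] ⊗ Λ` of operators on `Λ`. -/
def extendOp [Algebra ℂ R] : Module.End ℂ Lam →ₐ[ℂ] Module.End R (LamP R) :=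
  (((MvPolynomial.algebraTensorAlgEquiv (σ := ℕ+) ℂ R).toLinearEquiv.conjAlgEquiv ℂ).toAlgHom).comp
    (Module.End.baseChangeHom ℂ R Lam)

/-- The action of `D(k)[p₀] = ℂ[p₀] ⊗ D(k)` on `Λ[p₀]`. -/
def stableAction [Algebra ℂ R] (k : ℂ) : R ⊗[ℂ] stableOps k →ₐ[R] Module.End R (LamP R) :=
  Algebra.TensorProduct.lift (Algebra.ofId R (Module.End R (LamP R)))
    (extendOp.comp (stableOps k).val) fun p _ => Algebra.commutes p _

/-! ### The Laurent CMS integrals -/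

/-- The algebra `Λ^±[p₀]`, where `Λ^±` is freely generated by `p_a`, `a ∈ ℤ ∖ {0}`. -/
abbrev LaurP (R : Type) [CommRing R] : Type := MvPolynomial {a : ℤ // a ≠ 0} R

/-- The power sum `p_a ∈ Λ^±[p₀]` for all `a ∈ ℤ`, including the formal parameter `p₀`. -/
def pw (p₀ : R) (a : ℤ) : LaurP R :=
  if h : a ≠ 0 then MvPolynomial.X ⟨a, h⟩ else MvPolynomial.C p₀

/-- The algebra `Λ^±[p₀][x, x⁻¹]`; the element `x^l` is `LaurentPolynomial.T l`. -/
abbrev LaurX (R : Type) [CommRing R] : Type := LaurentPolynomial (LaurP R)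

/-- The `ℂ[p₀]`-linear map given on `f x^l`, `f ∈ Λ^±[p₀]`, by `g l f`. -/
def laurLift {M : Type} [AddCommGroup M] [Module R M] (g : ℤ → LaurP R →ₗ[R] M) :
    LaurX R →ₗ[R] M :=
  (Finsupp.lsum R g).comp (AddMonoidAlgebra.coeffLinearEquiv R).toLinearMap

theorem laurLift_apply {M : Type} [AddCommGroup M] [Module R M] (g : ℤ → LaurP R →ₗ[R] M)
    (f : LaurP R) (l : ℤ) :
    laurLift g (LaurentPolynomial.C f * LaurentPolynomial.T l) = g l f := by
  rw [← LaurentPolynomial.single_eq_C_mul_T]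
  exact Finsupp.sum_single_index (map_zero _)

/-- The derivation `Λ^±[p₀] → Λ^±[p₀][x, x⁻¹]` over `ℂ[p₀]` with `p_a ↦ a x^a`. -/
def dP : Derivation R (LaurP R) (LaurX R) :=
  MvPolynomial.mkDerivation R fun a => (a.1 : ℤ) • LaurentPolynomial.T a.1

/-- The differentiation `∂` of `Λ^±[p₀][x, x⁻¹]` with `∂ x = x`, `∂ p_a = a x^a`. -/
def del : Module.End R (LaurX R) :=
  laurLift fun l => (LinearMap.mulRight R (LaurentPolynomial.T l : LaurX R)).comp dP.toLinearMap +
    l • AddMonoidAlgebra.lsingle l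

theorem del_apply (f : LaurP R) (l : ℤ) :
    del (LaurentPolynomial.C f * LaurentPolynomial.T l) =
      dP f * LaurentPolynomial.T l + l • (LaurentPolynomial.C f * LaurentPolynomial.T l) := by
  rw [del, laurLift_apply, ← LaurentPolynomial.single_eq_C_mul_T]
  simp

/-- For `n > 0` and `s = 1` this is
`x^n p₀ + 2 x^{n-1} p₁ + ⋯ + 2 x p_{n-1} + p_n - 2 n x^n`; for `s = -1` it is the image of that
element under the involution `p_a ↦ p_{-a}`, `x ↦ x⁻¹`. -/
def deltaAux (p₀ : R) (s : ℤ) (n : ℕ) : LaurX R :=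
  LaurentPolynomial.C (pw p₀ 0) * LaurentPolynomial.T (s * n) +
    (2 : ℤ) • ∑ j ∈ Finset.Ico 1 n,
      LaurentPolynomial.C (pw p₀ (s * j)) * LaurentPolynomial.T (s * (n - j)) +
    LaurentPolynomial.C (pw p₀ (s * n)) - (2 * n : ℤ) • LaurentPolynomial.T (s * n)

/-- `Δ_{p₀}(x^l)`, which is `deltaAux 1 l` for `l > 0`, zero for `l = 0`, and
`-(Δ_{p₀}(x^{-l}))^*` for `l < 0`. -/
def deltaT (p₀ : R) (l : ℤ) : LaurX R := l.sign • deltaAux p₀ l.sign l.natAbs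

/-- The `Λ^±[p₀]`-linear operator `Δ_{p₀}`. -/
def delta (p₀ : R) : Module.End R (LaurX R) :=
  laurLift fun l => (LinearMap.mulRight R (deltaT p₀ l)).comp (AddMonoidAlgebra.lsingle 0)

theorem delta_apply (p₀ : R) (f : LaurP R) (l : ℤ) :
    delta p₀ (LaurentPolynomial.C f * LaurentPolynomial.T l) = LaurentPolynomial.C f * deltaT p₀ l := by
  rw [delta, laurLift_apply, ← LaurentPolynomial.single_eq_C]
  simp

/-- The infinite-dimensional Dunkl–Heckman operator `D_{k,p₀} = ∂ - (k/2) Δ_{p₀}`. -/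
def dunklInf [Algebra ℂ R] (p₀ : R) (k : ℂ) : Module.End R (LaurX R) := del - (algebraMap ℂ R (k / 2)) • delta p₀

/-- The operator `E_{p₀}`, `f x^l ↦ f p_l`. -/
def evalE (p₀ : R) : LaurX R →ₗ[R] LaurP R := laurLift fun l => LinearMap.mulRight R (pw p₀ l)

/-- The Laurent CMS integral `L^{(r)}_{k,p₀} = E_{p₀} ∘ D_{k,p₀}^r` on `Λ^±[p₀]`. -/
def laurentIntegral [Algebra ℂ R] (p₀ : R) (k : ℂ) (r : ℕ) : Module.End R (LaurP R) :=
  (evalE p₀).comp ((dunklInf p₀ k ^ r).comp (AddMonoidAlgebra.lsingle 0))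

/-- The inclusion `Λ[p₀] ⊂ Λ^±[p₀]`. -/
def incl : LamP R →ₐ[R] LaurP R :=
  MvPolynomial.rename fun a : ℕ+ => ⟨(a : ℤ), by exact_mod_cast a.ne_zero⟩

theorem incl_injective : Function.Injective (incl (R := R)) :=
  MvPolynomial.rename_injective _ fun a b h => by
    have h' := congrArg Subtype.val h
    simpa using h'

theorem pw_mem (p₀ : R) {a : ℤ} (ha : 0 ≤ a) : pw p₀ a ∈ (incl (R := R)).range := by
  rcases ha.eq_or_lt with rfl | h
  · exact ⟨MvPolynomial.C p₀, by simp [incl, pw]⟩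
  · lift a to ℕ using ha
    refine ⟨MvPolynomial.X ⟨a, by exact_mod_cast h⟩, ?_⟩
    have h0 : (a : ℤ) ≠ 0 := h.ne'
    rw [pw, dif_pos h0]
    exact MvPolynomial.rename_X _ _

/-- The subspace `Λ[p₀][x]` of `Λ^±[p₀][x, x⁻¹]`. -/
def posPart : Submodule R (LaurX R) :=
  Submodule.span R {F | ∃ (f : LamP R) (n : ℕ),
    F = LaurentPolynomial.C (incl f) * LaurentPolynomial.T (n : ℤ)}

theorem mem_posPart {g : LaurP R} (hg : g ∈ incl.range) {l : ℤ} (hl : 0 ≤ l) :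
    LaurentPolynomial.C g * LaurentPolynomial.T l ∈ posPart := by
  obtain ⟨f, rfl⟩ := hg
  lift l to ℕ using hl
  exact Submodule.subset_span ⟨f, l, rfl⟩

theorem mul_mem_posPart {g : LaurP R} (hg : g ∈ incl.range) {l : ℤ} (hl : 0 ≤ l) {F : LaurX R}
    (hF : F ∈ posPart) : F * (LaurentPolynomial.C g * LaurentPolynomial.T l) ∈ posPart := by
  induction hF using Submodule.span_induction with
  | mem F h =>
    obtain ⟨f, n, rfl⟩ := h
    have h : LaurentPolynomial.C (incl f) * LaurentPolynomial.T (n : ℤ) *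
        (LaurentPolynomial.C g * LaurentPolynomial.T l) =
        LaurentPolynomial.C (incl f * g) * LaurentPolynomial.T ((n : ℤ) + l) := by
      rw [map_mul, LaurentPolynomial.T_add]
      ring
    rw [h]
    exact mem_posPart (mul_mem ⟨f, rfl⟩ hg) (by positivity)
  | zero => rw [zero_mul]; exact zero_mem _
  | add F G _ _ hF hG => rw [add_mul]; exact add_mem hF hG
  | smul c F _ hF => rw [smul_mul_assoc]; exact Submodule.smul_mem _ c hF

theorem T_mem_posPart {l : ℤ} (hl : 0 ≤ l) : (LaurentPolynomial.T l : LaurX R) ∈ posPart := by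
  have := mem_posPart (one_mem (incl (R := R)).range) hl
  simpa using this

theorem dP_incl_mem (f : LamP R) : dP (incl f) ∈ posPart := by
  induction f using MvPolynomial.induction_on with
  | C a =>
    have : incl (MvPolynomial.C a) = algebraMap R (LaurP R) a := (incl (R := R)).commutes a
    rw [this, Derivation.map_algebraMap]
    exact zero_mem _
  | add p q hp hq => rw [map_add, map_add]; exact add_mem hp hq
  | mul_X p a hp =>
    have hX : dP (incl (MvPolynomial.X a : LamP R)) =
        ((a : ℕ) : ℤ) • LaurentPolynomial.T ((a : ℕ) : ℤ) := by
      simp [incl, dP, MvPolynomial.mkDerivation_X]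
    rw [map_mul, Derivation.leibniz, hX]
    refine add_mem ?_ ?_
    · rw [smul_comm, LaurentPolynomial.smul_eq_C_mul]
      exact zsmul_mem (mem_posPart ⟨p, rfl⟩ (by positivity)) _
    · rw [LaurentPolynomial.smul_eq_C_mul, mul_comm]
      have := mul_mem_posPart (g := incl (MvPolynomial.X a)) ⟨_, rfl⟩ (le_refl 0) hp
      simpa using this

theorem deltaT_mem (p₀ : R) {l : ℕ} : deltaT p₀ (l : ℤ) ∈ posPart := by
  rcases Nat.eq_zero_or_pos l with rfl | hl
  · simp [deltaT]
  · have hs : (l : ℤ).sign = 1 := Int.sign_eq_one_of_pos (by exact_mod_cast hl)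
    rw [deltaT, hs, one_smul, Int.natAbs_natCast, deltaAux]
    simp only [one_mul]
    refine sub_mem (add_mem (add_mem ?_ (zsmul_mem (sum_mem fun j hj => ?_) _)) ?_)
      (zsmul_mem (T_mem_posPart (by positivity)) _)
    · exact mem_posPart (pw_mem p₀ le_rfl) (by positivity)
    · have := (Finset.mem_Ico.1 hj).2
      exact mem_posPart (pw_mem p₀ (by positivity)) (by omega)
    · have := mem_posPart (pw_mem p₀ (a := (l : ℤ)) (by positivity)) (le_refl 0)
      simpa using this

theorem dunklInf_mem [Algebra ℂ R] (p₀ : R) (k : ℂ) {F : LaurX R} (hF : F ∈ posPart) :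
    dunklInf p₀ k F ∈ posPart := by
  induction hF using Submodule.span_induction with
  | mem F h =>
    obtain ⟨f, n, rfl⟩ := h
    rw [dunklInf, LinearMap.sub_apply, LinearMap.smul_apply, del_apply, delta_apply]
    refine sub_mem (add_mem ?_ (zsmul_mem (mem_posPart ⟨f, rfl⟩ (by positivity)) _))
      (Submodule.smul_mem _ _ ?_)
    · have := mul_mem_posPart (one_mem (incl (R := R)).range) (l := (n : ℤ)) (by positivity) (dP_incl_mem f)
      simpa using this
    · have := mul_mem_posPart (g := incl f) ⟨f, rfl⟩ (le_refl 0) (deltaT_mem p₀ (l := n))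
      rw [mul_comm]
      simpa using this
  | zero => rw [map_zero]; exact zero_mem _
  | add F G _ _ hF hG => rw [map_add]; exact add_mem hF hG
  | smul c F _ hF => rw [map_smul]; exact Submodule.smul_mem _ c hF

theorem evalE_mem (p₀ : R) {F : LaurX R} (hF : F ∈ posPart) :
    evalE p₀ F ∈ LinearMap.range (incl (R := R)).toLinearMap := by
  induction hF using Submodule.span_induction with
  | mem F h =>
    obtain ⟨f, n, rfl⟩ := h
    rw [evalE, laurLift_apply, LinearMap.mulRight_apply]
    exact mul_mem (S := Subalgebra R (LaurP R)) (s := incl.range) ⟨f, rfl⟩ (pw_mem p₀ (by positivity))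
  | zero => rw [map_zero]; exact zero_mem _
  | add F G _ _ hF hG => rw [map_add]; exact add_mem hF hG
  | smul c F _ hF => rw [map_smul]; exact Submodule.smul_mem _ c hF

theorem laurentIntegral_incl_mem [Algebra ℂ R] (p₀ : R) (k : ℂ) (r : ℕ) (f : LamP R) :
    laurentIntegral p₀ k r (incl f) ∈ LinearMap.range incl.toLinearMap := by
  refine evalE_mem p₀ ?_
  induction r with
  | zero =>
    have := mem_posPart (g := incl f) ⟨f, rfl⟩ (le_refl 0)
    rw [← LaurentPolynomial.single_eq_C_mul_T] at this
    simpa using this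
  | succ r ih =>
    rw [pow_succ']
    exact dunklInf_mem p₀ k ih

/-- The Laurent CMS integral `L^{(r)}_{k,p₀}` as an operator on `Λ[p₀]`, which it preserves. -/
def laurentIntegralRes [Algebra ℂ R] (p₀ : R) (k : ℂ) (r : ℕ) : Module.End R (LamP R) :=
  (LinearEquiv.ofInjective incl.toLinearMap incl_injective).symm.toLinearMap.comp
    (((laurentIntegral p₀ k r).comp incl.toLinearMap).codRestrict (LinearMap.range incl.toLinearMap)
      (laurentIntegral_incl_mem p₀ k r))

theorem incl_laurentIntegralRes [Algebra ℂ R] (p₀ : R) (k : ℂ) (r : ℕ) (f : LamP R) :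
    incl (laurentIntegralRes p₀ k r f) = laurentIntegral p₀ k r (incl f) := by
  have := LinearEquiv.ofInjective_symm_apply (f := incl.toLinearMap) (h := incl_injective)
    ⟨laurentIntegral p₀ k r (incl f), laurentIntegral_incl_mem p₀ k r f⟩
  exact this

/-- The algebra `D_L(k,p₀)` of operators on `Λ[p₀]` generated over `ℂ[p₀]` by the Laurent CMS
integrals `L^{(r)}_{k,p₀}`. -/
def laurentAlgebra [Algebra ℂ R] (p₀ : R) (k : ℂ) : Subalgebra R (Module.End R (LamP R)) :=
  Algebra.adjoin R (Set.range (laurentIntegralRes p₀ k))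

end Param

end CMS

end

/-! Both algebras turn out to be generated by the same operators on `Λ`, namely `freeIntegral`: E_0
∘ (∂ - kΔ')^r restricted to `Λ`, where E_0 sends 1 to 0 and x^l to p_l for l > 0, and Δ' sends x^l
to x^{l-1} p_1 + ... + p_l - l x^l. None of them involves p_0.

Laurent side. On `Λ[x]` one has Δ_{p_0} = 2Δ' + p_0 - C ∘ E_{p_0}, with C the inclusion of `Λ`.
Hence D_{k,p_0} differs from ∂ - kΔ' by a scalar and a multiple of C ∘ E_{p_0}. Such a perturbation
does not change the algebra generated by the operators E D^r C (`comp_pow_comp_mem_adjoin`). The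
parameter left in E_{p_0} multiplies only the constant term in x, and the constant term of (∂ -
kΔ')g is -k E_0(g). So E_{p_0} and E_0 give generators that are triangular combinations of each
other (`freeEval_succ`, `laurentAlgebra_eq`).

Stable side. Putting p_0 = N and x = x_i turns D_{k,p_0} into D_{i,N} (`phiX_dunklX`), so each
generator induces an element of every D_N(k), of order at most r for all N. Conversely, an element
of D_N(k) is a combination of words in the D_{i,N} acting on symmetric polynomials. Since [D_{i,N},
D_{j,N}] is a combination of permutations (`dunklHeckman_commutator`), words may be reordered modulo
shorter ones, and the longest words have a commutative symbol. Iterated commutators with a symmetric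
f evaluate this symbol at the vector (x_i ∂f/∂x_i)_i. These vectors take arbitrary values, so the
symbol is unique, it is symmetric, and an operator of order at most m needs only words of length at
most m (`IsDiffOp.mem_wordSpan`). The generators have the power sums as symbols, so descending
induction on length shows that such an operator is induced by an element of a finite-dimensional
space `freeSpan` which does not depend on N (`exists_freeSpan_induces`). In a finite-dimensional
space the elements inducing zero on Λ_N vanish for large N, so a compatible sequence of bounded
order comes from a single element (`exists_induces_of_mem_stableLimit`).

The theorem follows by extending scalars from ℂ to ℂ[p_0]. -/

noncomputable section

namespace CMS

/-! ### Commutators of the Dunkl–Heckman operators -/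

section Commutators

variable {N : ℕ}

/-- `deltaPair` extended by zero to the diagonal. -/
def heckPair (i j : Fin N) : Module.End ℂ (Poly N) := if h : i ≠ j then deltaPair i j h else 0

theorem heckPair_self (i : Fin N) : heckPair i i = 0 := by simp [heckPair]

theorem dunklHeckman_eq (k : ℂ) (i : Fin N) :
    dunklHeckman k i = eulerOp i - (k / 2) • ∑ j, heckPair i j := by
  rw [dunklHeckman]
  congr 2
  have h : ∀ j : {j : Fin N // i ≠ j}, deltaPair i j.1 j.2 = heckPair i j.1 := fun j => by
    simp [heckPair, j.2]
  rw [Finset.sum_congr rfl fun j _ => h j,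
    ← Finset.sum_subtype (Finset.univ.filter (i ≠ ·)) (by simp) (heckPair i), Finset.sum_filter]
  refine Finset.sum_congr rfl fun j _ => ?_
  split_ifs with h
  · rfl
  · rw [not_not.1 h, heckPair_self]

theorem permVar_mul (e e' : Equiv.Perm (Fin N)) (f : Poly N) :
    permVar e (permVar e' f) = permVar (e * e') f := by
  simp only [permVar, MvPolynomial.rename_rename]
  rfl

theorem permVar_X (e : Equiv.Perm (Fin N)) (i : Fin N) :
    permVar e (MvPolynomial.X i) = MvPolynomial.X (e i) := by simp [permVar]

theorem permVar_heckPair (e : Equiv.Perm (Fin N)) (i j : Fin N) (f : Poly N) :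
    permVar e (heckPair i j f) = heckPair (e i) (e j) (permVar e f) := by
  by_cases h : i = j
  · subst h; simp [heckPair_self]
  · have h' : e i ≠ e j := fun h' => h (e.injective h')
    simp only [heckPair, ne_eq, h, h', not_false_eq_true, dif_pos, deltaPair, LinearMap.coe_mk,
      AddHom.coe_mk, map_mul, map_add, permVar_X, permVar_divDiff e h]

/-- Differences of distinct variables can be cancelled, so most identities below are proved by
clearing denominators with this relation. It also covers the diagonal, where both sides are zero. -/
theorem sub_mul_heckPair (i j : Fin N) (f : Poly N) :
    (MvPolynomial.X i - MvPolynomial.X j) * heckPair i j f =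
      (MvPolynomial.X i + MvPolynomial.X j) * (f - permVar (Equiv.swap i j) f) := by
  by_cases h : i = j
  · subst h; simp [heckPair_self, permVar]
  · simp only [heckPair, ne_eq, h, not_false_eq_true, dif_pos, deltaPair, LinearMap.coe_mk,
      AddHom.coe_mk]
    rw [divDiff_spec]
    ring

theorem heckPair_antisymm (i j : Fin N) : heckPair j i = -heckPair i j := by
  by_cases h : i = j
  · subst h; simp [heckPair_self]
  · refine LinearMap.ext fun f => ?_
    apply mul_left_cancel₀ (X_sub_X_ne_zero h)
    have h1 := sub_mul_heckPair i j f
    have h2 := sub_mul_heckPair j i f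
    rw [Equiv.swap_comm] at h2
    rw [LinearMap.neg_apply]
    linear_combination -h2 + h1

theorem polyEnd_neg_mul (A B : Module.End ℂ (Poly N)) : -A * B = -(A * B) := rfl

theorem polyEnd_mul_neg (A B : Module.End ℂ (Poly N)) : A * -B = -(A * B) :=
  LinearMap.ext fun f => map_neg A (B f)

theorem eulerOp_mul (i : Fin N) (f g : Poly N) :
    eulerOp i (f * g) = f * eulerOp i g + eulerOp i f * g := by
  simp only [eulerOp, Module.End.mul_apply, LinearMap.mulLeft_apply, Derivation.coeFn_coe,
    Derivation.leibniz, smul_eq_mul]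
  ring

theorem eulerOp_X_self (i : Fin N) : eulerOp i (MvPolynomial.X i : Poly N) = MvPolynomial.X i := by
  simp [eulerOp]

theorem eulerOp_X_of_ne {i j : Fin N} (h : j ≠ i) :
    eulerOp i (MvPolynomial.X j : Poly N) = 0 := by
  simp [eulerOp, MvPolynomial.pderiv_X_of_ne h]

theorem eulerOp_comm (i j : Fin N) : Commute (eulerOp (N := N) i) (eulerOp j) := by
  by_cases hij : i = j
  · subst hij; exact Commute.refl _
  refine LinearMap.ext fun f => ?_
  simp only [Module.End.mul_apply]
  induction f using MvPolynomial.induction_on with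
  | C a => simp [eulerOp]
  | add p q hp hq => simp only [map_add, hp, hq]
  | mul_X p l hp =>
    simp only [eulerOp_mul, map_add, hp]
    rcases eq_or_ne l i with rfl | hi
    · rw [eulerOp_X_self, eulerOp_X_of_ne hij]
      simp
    · rcases eq_or_ne l j with rfl | hj
      · rw [eulerOp_X_self, eulerOp_X_of_ne hi]
        simp
      · simp [eulerOp_X_of_ne hi, eulerOp_X_of_ne hj]

/-- The operator x_i ∂/∂x_i kills the coefficient, which does not contain x_i, and commutes with a
swap fixing i. -/
theorem eulerOp_comm_heckPair {i j l : Fin N} (hj : j ≠ i) (hl : l ≠ i) :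
    Commute (eulerOp i) (heckPair j l) := by
  by_cases h : j = l
  · subst h; rw [heckPair_self]; exact Commute.zero_right _
  refine LinearMap.ext fun f => mul_left_cancel₀ (X_sub_X_ne_zero h) ?_
  have h0 := sub_mul_heckPair j l f
  have h1 := congrArg (eulerOp i) h0
  have h2 := sub_mul_heckPair j l (eulerOp i f)
  have h3 := permVar_eulerOp (Equiv.swap j l) i f
  rw [Equiv.swap_apply_of_ne_of_ne hj.symm hl.symm] at h3
  simp only [eulerOp_mul, map_add, map_sub, eulerOp_X_of_ne hj, eulerOp_X_of_ne hl, h3] at h1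
  simp only [Module.End.mul_apply]
  linear_combination h1 - h2

/-- The sum is invariant under the swap and annihilates (x_i + x_j)/(x_i - x_j), which is
homogeneous of degree 0 in x_i and x_j. -/
theorem eulerOp_add_comm_heckPair (i j : Fin N) :
    Commute (eulerOp i + eulerOp j) (heckPair i j) := by
  by_cases h : i = j
  · subst h; rw [heckPair_self]; exact Commute.zero_right _
  refine LinearMap.ext fun f => mul_left_cancel₀ (X_sub_X_ne_zero h) ?_
  have h0 := sub_mul_heckPair i j f
  have h1 := congrArg (eulerOp i) h0
  have h1' := congrArg (eulerOp j) h0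
  have h2 := sub_mul_heckPair i j (eulerOp i f)
  have h2' := sub_mul_heckPair i j (eulerOp j f)
  have h3 := permVar_eulerOp (Equiv.swap i j) i f
  have h3' := permVar_eulerOp (Equiv.swap i j) j f
  rw [Equiv.swap_apply_left] at h3
  rw [Equiv.swap_apply_right] at h3'
  simp only [eulerOp_mul, map_add, map_sub, eulerOp_X_of_ne h, eulerOp_X_of_ne (Ne.symm h),
    eulerOp_X_self] at h1 h1'
  simp only [Module.End.mul_apply, LinearMap.add_apply, map_add]
  rw [← h3] at h2
  rw [← h3'] at h2'
  linear_combination h1 + h1' - h2 - h2' - h0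

theorem heckPair_comm_of_disjoint {i j l m : Fin N} (h1 : i ≠ l) (h2 : i ≠ m) (h3 : j ≠ l)
    (h4 : j ≠ m) : Commute (heckPair i j) (heckPair l m) := by
  by_cases h : i = j
  · subst h; rw [heckPair_self]; exact Commute.zero_left _
  by_cases h' : l = m
  · subst h'; rw [heckPair_self]; exact Commute.zero_right _
  refine LinearMap.ext fun f => ?_
  simp only [Module.End.mul_apply]
  refine mul_left_cancel₀ (X_sub_X_ne_zero h) (mul_left_cancel₀ (X_sub_X_ne_zero h') ?_)
  have e1 := sub_mul_heckPair i j (heckPair l m f)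
  have e2 := sub_mul_heckPair l m (heckPair i j f)
  rw [permVar_heckPair, Equiv.swap_apply_of_ne_of_ne h1.symm h3.symm,
    Equiv.swap_apply_of_ne_of_ne h2.symm h4.symm] at e1
  rw [permVar_heckPair, Equiv.swap_apply_of_ne_of_ne h1 h2,
    Equiv.swap_apply_of_ne_of_ne h3 h4] at e2
  have e3 := sub_mul_heckPair l m f
  have e4 := sub_mul_heckPair i j f
  have e5 := sub_mul_heckPair l m (permVar (Equiv.swap i j) f)
  have e6 := sub_mul_heckPair i j (permVar (Equiv.swap l m) f)
  have hs : permVar (Equiv.swap i j) (permVar (Equiv.swap l m) f) =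
      permVar (Equiv.swap l m) (permVar (Equiv.swap i j) f) := by
    have hss : Equiv.swap i j * Equiv.swap l m = Equiv.swap l m * Equiv.swap i j := by
      ext a
      simp only [Equiv.Perm.mul_apply, Equiv.swap_apply_def]
      grind
    rw [permVar_mul, permVar_mul, hss]
  rw [hs] at e6
  linear_combination (MvPolynomial.X l - MvPolynomial.X m) * e1 -
    (MvPolynomial.X i - MvPolynomial.X j) * e2 +
    (MvPolynomial.X i + MvPolynomial.X j) * (e3 - e5) -
    (MvPolynomial.X l + MvPolynomial.X m) * (e4 - e6)

theorem algebraMap_heckPair {i j : Fin N} (h : i ≠ j) (f : Poly N) :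
    algebraMap (Poly N) (FractionRing (Poly N)) (heckPair i j f) =
      (algebraMap (Poly N) (FractionRing (Poly N)) (MvPolynomial.X i) +
        algebraMap (Poly N) (FractionRing (Poly N)) (MvPolynomial.X j)) /
      (algebraMap (Poly N) (FractionRing (Poly N)) (MvPolynomial.X i) -
        algebraMap (Poly N) (FractionRing (Poly N)) (MvPolynomial.X j)) *
      (algebraMap (Poly N) (FractionRing (Poly N)) f -
        algebraMap (Poly N) (FractionRing (Poly N)) (permVar (Equiv.swap i j) f)) := by
  have h1 := congrArg (algebraMap (Poly N) (FractionRing (Poly N))) (sub_mul_heckPair i j f)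
  have h2 : algebraMap (Poly N) (FractionRing (Poly N)) (MvPolynomial.X i) -
      algebraMap (Poly N) (FractionRing (Poly N)) (MvPolynomial.X j) ≠ 0 := by
    rw [← map_sub]
    exact (map_ne_zero_iff _ (IsFractionRing.injective _ _)).2 (X_sub_X_ne_zero h)
  simp only [map_mul, map_sub, map_add] at h1
  field_simp
  linear_combination h1

/-- Write a_ij = (x_i + x_j)/(x_i - x_j) in the fraction field and expand. The identity and the
single swaps cancel, and the two 3-cycles get coefficients ±1 because a_ij a_jl + a_jl a_li + a_li
a_ij = -1. -/
theorem heckPair_triple {i j l : Fin N} (hij : i ≠ j) (hil : i ≠ l) (hjl : j ≠ l) (f : Poly N) :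
    (heckPair i j * heckPair j l - heckPair j l * heckPair i j +
      (heckPair i l * heckPair j i - heckPair j i * heckPair i l) +
      (heckPair i l * heckPair j l - heckPair j l * heckPair i l)) f =
    permVar (Equiv.swap i j * Equiv.swap j l) f - permVar (Equiv.swap j l * Equiv.swap i j) f := by
  rw [heckPair_antisymm i j]
  apply IsFractionRing.injective (Poly N) (FractionRing (Poly N))
  have hK : ∀ {a b : Fin N}, a ≠ b →
      algebraMap (Poly N) (FractionRing (Poly N)) (MvPolynomial.X a) -
      algebraMap (Poly N) (FractionRing (Poly N)) (MvPolynomial.X b) ≠ 0 := by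
    intro a b h
    rw [← map_sub]
    exact (map_ne_zero_iff _ (IsFractionRing.injective _ _)).2 (X_sub_X_ne_zero h)
  -- The six products of two distinct swaps are only two 3-cycles; `s1` to `s4` bring each to one of
  -- two normal forms, so that `ring` sees equal terms.
  have s1 : ∀ {a b c : Fin N}, a ≠ b → a ≠ c → b ≠ c →
      Equiv.swap a b * Equiv.swap b c = Equiv.swap b c * Equiv.swap a c := by
    intro a b c h1 h2 h3
    ext x
    simp only [Equiv.Perm.mul_apply, Equiv.swap_apply_def]
    grind
  have s2 : ∀ {a b c : Fin N}, a ≠ b → a ≠ c → b ≠ c →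
      Equiv.swap a c * Equiv.swap a b = Equiv.swap a b * Equiv.swap b c := by
    intro a b c h1 h2 h3
    ext x
    simp only [Equiv.Perm.mul_apply, Equiv.swap_apply_def]
    grind
  have s3 : ∀ {a b c : Fin N}, a ≠ b → a ≠ c → b ≠ c →
      Equiv.swap a b * Equiv.swap a c = Equiv.swap b c * Equiv.swap a b := by
    intro a b c h1 h2 h3
    ext x
    simp only [Equiv.Perm.mul_apply, Equiv.swap_apply_def]
    grind
  have s4 : ∀ {a b c : Fin N}, a ≠ b → a ≠ c → b ≠ c →
      Equiv.swap a c * Equiv.swap b c = Equiv.swap b c * Equiv.swap a b := by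
    intro a b c h1 h2 h3
    ext x
    simp only [Equiv.Perm.mul_apply, Equiv.swap_apply_def]
    grind
  simp only [LinearMap.add_apply, LinearMap.sub_apply, Module.End.mul_apply, LinearMap.neg_apply,
    map_add, map_sub, map_neg, algebraMap_heckPair hij, algebraMap_heckPair hil,
    algebraMap_heckPair hjl, permVar_heckPair, Equiv.swap_apply_left, Equiv.swap_apply_right,
    Equiv.swap_apply_of_ne_of_ne hil.symm hjl.symm, Equiv.swap_apply_of_ne_of_ne hij hil,
    Equiv.swap_apply_of_ne_of_ne hij.symm hjl, heckPair_antisymm j l,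
    heckPair_antisymm i j, permVar_mul]
  rw [← s1 hij hil hjl, s2 hij hil hjl, s3 hij hil hjl, s4 hij hil hjl]
  have n1 := hK hij
  have n2 := hK hil
  have n3 := hK hjl
  field_simp
  ring

/-- When l equals i or j both sides vanish, so the sum in the commutator may run over all indices.
-/
theorem heckPair_commutators (i j l : Fin N) (hij : i ≠ j) (f : Poly N) :
    (heckPair i j * heckPair j l - heckPair j l * heckPair i j +
      (heckPair i l * heckPair j i - heckPair j i * heckPair i l) +
      (heckPair i l * heckPair j l - heckPair j l * heckPair i l)) f =
    permVar (Equiv.swap i j * Equiv.swap j l) f - permVar (Equiv.swap j l * Equiv.swap i j) f := by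
  rcases eq_or_ne l i with rfl | hl
  · rw [heckPair_self, heckPair_antisymm l j, Equiv.swap_comm j l]
    simp
  rcases eq_or_ne l j with rfl | hl'
  · rw [heckPair_self, heckPair_antisymm i l]
    simp [Equiv.swap_self, ← Equiv.Perm.one_def]
  exact heckPair_triple hij hl.symm hl'.symm f

/-- The commutator of two Heckman operators is a combination of permutations. -/
theorem dunklHeckman_commutator (k : ℂ) {i j : Fin N} (hij : i ≠ j) (f : Poly N) :
    dunklHeckman k i (dunklHeckman k j f) - dunklHeckman k j (dunklHeckman k i f) =
      (k / 2) ^ 2 • ∑ l, (permVar (Equiv.swap i j * Equiv.swap j l) f -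
        permVar (Equiv.swap j l * Equiv.swap i j) f) := by
  have hE : ∀ a b : Fin N, a ≠ b → eulerOp a * ∑ l, heckPair b l - (∑ l, heckPair b l) * eulerOp a =
      eulerOp a * heckPair b a - heckPair b a * eulerOp a := by
    intro a b hab
    rw [Finset.mul_sum, Finset.sum_mul, ← Finset.sum_sub_distrib]
    refine Finset.sum_eq_single a (fun l _ hl => ?_) (by simp)
    exact sub_eq_zero.2 (eulerOp_comm_heckPair hab.symm hl)
  -- By this equality the terms mixing Euler operators and swaps cancel in the full commutator.
  have h1 : eulerOp i * heckPair j i - heckPair j i * eulerOp i =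
      eulerOp j * heckPair i j - heckPair i j * eulerOp j := by
    have := (eulerOp_add_comm_heckPair i j).eq
    rw [heckPair_antisymm i j]
    simp only [add_mul, mul_add] at this
    simp only [polyEnd_neg_mul, polyEnd_mul_neg]
    rw [← sub_eq_zero] at this ⊢
    rw [← neg_eq_zero, ← this]
    abel
  -- Pairs without a common index commute, so for l ≠ j only m = i and m = l survive. For l = j
  -- every m shares the index j, so the whole row is kept.
  have hB : ∀ l, ∑ m, (heckPair i l * heckPair j m - heckPair j m * heckPair i l) =
      (heckPair i l * heckPair j i - heckPair j i * heckPair i l) +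
      (heckPair i l * heckPair j l - heckPair j l * heckPair i l) +
      if l = j then ∑ m, (heckPair i j * heckPair j m - heckPair j m * heckPair i j) else 0 := by
    intro l
    split_ifs with hlj
    · subst hlj
      rw [heckPair_self, heckPair_antisymm i l]
      simp [polyEnd_neg_mul, polyEnd_mul_neg]
    · rcases eq_or_ne l i with rfl | hli
      · simp [heckPair_self]
      · rw [add_zero]
        have h0 : ∀ m, m ∉ ({i, l} : Finset (Fin N)) →
            heckPair i l * heckPair j m - heckPair j m * heckPair i l = 0 := by
          intro m hm
          simp only [Finset.mem_insert, Finset.mem_singleton, not_or] at hm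
          exact sub_eq_zero.2
            (heckPair_comm_of_disjoint hij (Ne.symm hm.1) hlj (Ne.symm hm.2))
        rw [← Finset.sum_subset (Finset.subset_univ _) fun m _ hm => h0 m hm,
          Finset.sum_pair (Ne.symm hli)]
  have hS : (∑ l, heckPair i l) * ∑ m, heckPair j m - (∑ m, heckPair j m) * ∑ l, heckPair i l =
      ∑ l, (heckPair i j * heckPair j l - heckPair j l * heckPair i j +
      (heckPair i l * heckPair j i - heckPair j i * heckPair i l) +
      (heckPair i l * heckPair j l - heckPair j l * heckPair i l)) := by
    have : (∑ l, heckPair i l) * ∑ m, heckPair j m - (∑ m, heckPair j m) * ∑ l, heckPair i l =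
        ∑ l, ∑ m, (heckPair i l * heckPair j m - heckPair j m * heckPair i l) := by
      simp only [Finset.sum_sub_distrib, Finset.sum_mul_sum]
      congr 1
      rw [Finset.sum_comm]
    rw [this, Finset.sum_congr rfl fun l _ => hB l]
    simp only [Finset.sum_add_distrib, Finset.sum_ite_eq', Finset.mem_univ, if_true]
    abel
  have key : dunklHeckman k i * dunklHeckman k j - dunklHeckman k j * dunklHeckman k i =
      (k / 2) ^ 2 • ∑ l, (heckPair i j * heckPair j l - heckPair j l * heckPair i j +
      (heckPair i l * heckPair j i - heckPair j i * heckPair i l) +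
      (heckPair i l * heckPair j l - heckPair j l * heckPair i l)) := by
    rw [← hS, dunklHeckman_eq, dunklHeckman_eq]
    have e1 := (eulerOp_comm i j).eq
    have e2 := hE i j hij
    have e3 := hE j i hij.symm
    rw [h1, ← e3] at e2
    generalize (∑ l, heckPair i l) = A at *
    generalize (∑ l, heckPair j l) = B at *
    simp only [sub_mul, mul_sub, smul_mul_assoc, mul_smul_comm, e1, smul_smul, pow_two, smul_sub]
    have e4 := congrArg ((k / 2) • ·) e2
    simp only [smul_sub] at e4
    rw [← sub_eq_zero] at e4 ⊢
    rw [← neg_eq_zero, ← e4]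
    abel
  have := LinearMap.congr_fun key f
  simp only [LinearMap.sub_apply, Module.End.mul_apply] at this
  rw [this, LinearMap.smul_apply, LinearMap.sum_apply]
  congr 1
  exact Finset.sum_congr rfl fun l _ => heckPair_commutators i j l hij f

end Commutators

/-! ### The filtration by words in the Dunkl–Heckman operators and symbols -/

section Symbols

variable {N : ℕ}

/-- The inclusion of `Λ_N` into the polynomial algebra. -/
def symIncl (N : ℕ) : SymN N →ₗ[ℂ] Poly N :=
  (MvPolynomial.symmetricSubalgebra (Fin N) ℂ).val.toLinearMap

theorem symIncl_apply (f : SymN N) : symIncl N f = f.1 := rfl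

theorem permVar_sym (e : Equiv.Perm (Fin N)) (f : SymN N) : permVar e f.1 = f.1 :=
  (MvPolynomial.mem_symmetricSubalgebra _).1 f.2 e

/-- A word in the Dunkl–Heckman operators, acting on symmetric polynomials. -/
def dunklWord (k : ℂ) : List (Fin N) → (SymN N →ₗ[ℂ] Poly N)
  | [] => symIncl N
  | i :: l => (dunklHeckman k i).comp (dunklWord k l)

/-- The span of the words of length less than `n`. -/
def wordSpan (k : ℂ) (N n : ℕ) : Submodule ℂ (SymN N →ₗ[ℂ] Poly N) :=
  Submodule.span ℂ {T | ∃ l : List (Fin N), l.length < n ∧ T = dunklWord k l}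

theorem dunklWord_mem {k : ℂ} {n : ℕ} {l : List (Fin N)} (h : l.length < n) :
    dunklWord k l ∈ wordSpan k N n := Submodule.subset_span ⟨l, h, rfl⟩

theorem wordSpan_mono {k : ℂ} {m n : ℕ} (h : m ≤ n) : wordSpan k N m ≤ wordSpan k N n :=
  Submodule.span_mono fun _ ⟨l, hl, e⟩ => ⟨l, hl.trans_le h, e⟩

theorem dunklHeckman_comp_mem {k : ℂ} {n : ℕ} {T : SymN N →ₗ[ℂ] Poly N} (i : Fin N)
    (hT : T ∈ wordSpan k N n) : (dunklHeckman k i).comp T ∈ wordSpan k N (n + 1) := by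
  induction hT using Submodule.span_induction with
  | mem T h =>
    obtain ⟨l, hl, rfl⟩ := h
    exact dunklWord_mem (l := i :: l) (by simpa using hl)
  | zero => rw [LinearMap.comp_zero]; exact zero_mem _
  | add S T _ _ hS hT => rw [LinearMap.comp_add]; exact add_mem hS hT
  | smul c T _ hT => rw [LinearMap.comp_smul]; exact Submodule.smul_mem _ c hT

/-- A permutation moves past the letters by relabelling them and is absorbed by the symmetric
argument. Restricting to Λ_N is what removes permutations from the algebra. -/
theorem permVar_comp_dunklWord (k : ℂ) (e : Equiv.Perm (Fin N)) (l : List (Fin N)) :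
    (permVar e).toLinearMap.comp (dunklWord k l) = dunklWord k (l.map e) := by
  induction l with
  | nil => exact LinearMap.ext fun f => permVar_sym e f
  | cons i l ih =>
    refine LinearMap.ext fun f => ?_
    change permVar e (dunklHeckman k i (dunklWord k l f)) =
      dunklHeckman k (e i) (dunklWord k (l.map e) f)
    rw [← ih, ← permVar_dunklHeckman]
    rfl

theorem permVar_comp_mem {k : ℂ} {n : ℕ} {T : SymN N →ₗ[ℂ] Poly N} (e : Equiv.Perm (Fin N))
    (hT : T ∈ wordSpan k N n) : (permVar e).toLinearMap.comp T ∈ wordSpan k N n := by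
  induction hT using Submodule.span_induction with
  | mem T h =>
    obtain ⟨l, hl, rfl⟩ := h
    rw [permVar_comp_dunklWord]
    exact dunklWord_mem (by simpa using hl)
  | zero => rw [LinearMap.comp_zero]; exact zero_mem _
  | add S T _ _ hS hT => rw [LinearMap.comp_add]; exact add_mem hS hT
  | smul c T _ hT => rw [LinearMap.comp_smul]; exact Submodule.smul_mem _ c hT

/-- An adjacent transposition costs a combination of permutations applied to a word two letters
shorter, which is again a combination of such words. -/
theorem dunklWord_perm (k : ℂ) {l l' : List (Fin N)} (h : l.Perm l') :
    dunklWord k l - dunklWord k l' ∈ wordSpan k N l.length := by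
  induction h with
  | nil => rw [sub_self]; exact zero_mem _
  | cons i _ ih =>
    have := dunklHeckman_comp_mem i ih
    rwa [LinearMap.comp_sub] at this
  | swap i j l =>
    rcases eq_or_ne i j with rfl | hij
    · rw [sub_self]; exact zero_mem _
    have : dunklWord k (j :: i :: l) - dunklWord k (i :: j :: l) = (k / 2) ^ 2 • ∑ a,
        ((permVar (Equiv.swap j i * Equiv.swap i a)).toLinearMap.comp (dunklWord k l) -
        (permVar (Equiv.swap i a * Equiv.swap j i)).toLinearMap.comp (dunklWord k l)) := by
      refine LinearMap.ext fun f => ?_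
      have := dunklHeckman_commutator k hij.symm (dunklWord k l f)
      simpa [dunklWord] using this
    rw [this]
    have hl : dunklWord k l ∈ wordSpan k N (j :: i :: l).length :=
      dunklWord_mem (by simp)
    exact Submodule.smul_mem _ _ (sum_mem fun a _ =>
      sub_mem (permVar_comp_mem _ hl) (permVar_comp_mem _ hl))
  | trans h1 _ ih1 ih2 =>
    rw [← h1.length_eq] at ih2
    have := add_mem ih1 ih2
    rwa [sub_add_sub_cancel] at this

/-! ### Symbols of combinations of words -/

/-- The relation "modulo words of length less than `n`, the operator `T` is a combination of words
of length `n` whose commutative image is `Q`". -/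
def symbolRel (k : ℂ) (N n : ℕ) : Submodule ℂ ((SymN N →ₗ[ℂ] Poly N) × Poly N) :=
  Submodule.span ℂ
    ({p | ∃ l : List (Fin N), l.length = n ∧ p = (dunklWord k l, (l.map MvPolynomial.X).prod)} ∪
      {p | ∃ l : List (Fin N), l.length < n ∧ p = (dunklWord k l, 0)})

theorem symbolRel_of_mem {k : ℂ} {n : ℕ} {T : SymN N →ₗ[ℂ] Poly N} (hT : T ∈ wordSpan k N n) :
    (T, 0) ∈ symbolRel k N n := by
  induction hT using Submodule.span_induction with
  | mem T h =>
    obtain ⟨l, hl, rfl⟩ := h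
    exact Submodule.subset_span (Or.inr ⟨l, hl, rfl⟩)
  | zero => exact zero_mem _
  | add S T _ _ hS hT => simpa using add_mem hS hT
  | smul c T _ hT => simpa using Submodule.smul_mem _ c hT

theorem exists_symbol {k : ℂ} {n : ℕ} {T : SymN N →ₗ[ℂ] Poly N} (hT : T ∈ wordSpan k N (n + 1)) :
    ∃ Q, (T, Q) ∈ symbolRel k N n := by
  induction hT using Submodule.span_induction with
  | mem T h =>
    obtain ⟨l, hl, rfl⟩ := h
    rcases Nat.lt_succ_iff_lt_or_eq.1 hl with hl | hl
    · exact ⟨0, Submodule.subset_span (Or.inr ⟨l, hl, rfl⟩)⟩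
    · exact ⟨_, Submodule.subset_span (Or.inl ⟨l, hl, rfl⟩)⟩
  | zero => exact ⟨0, zero_mem _⟩
  | add S T _ _ hS hT =>
    obtain ⟨P, hP⟩ := hS
    obtain ⟨Q, hQ⟩ := hT
    refine ⟨P + Q, ?_⟩
    have := add_mem hP hQ
    rwa [Prod.mk_add_mk] at this
  | smul c T _ hT =>
    obtain ⟨Q, hQ⟩ := hT
    refine ⟨c • Q, ?_⟩
    have := Submodule.smul_mem _ c hQ
    rwa [Prod.smul_mk] at this

theorem mem_wordSpan_of_symbolRel {k : ℂ} {n : ℕ} {p : (SymN N →ₗ[ℂ] Poly N) × Poly N}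
    (hp : p ∈ symbolRel k N n) : p.1 ∈ wordSpan k N (n + 1) := by
  induction hp using Submodule.span_induction with
  | mem p h =>
    rcases h with ⟨l, hl, rfl⟩ | ⟨l, hl, rfl⟩
    · exact dunklWord_mem (by omega)
    · exact dunklWord_mem (by omega)
  | zero => exact zero_mem _
  | add p q _ _ hp hq => exact add_mem hp hq
  | smul c p _ hp => exact Submodule.smul_mem _ c hp

theorem isHomogeneous_of_symbolRel {k : ℂ} {n : ℕ} {p : (SymN N →ₗ[ℂ] Poly N) × Poly N}
    (hp : p ∈ symbolRel k N n) : p.2.IsHomogeneous n := by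
  rw [← MvPolynomial.mem_homogeneousSubmodule]
  induction hp using Submodule.span_induction with
  | mem p h =>
    rcases h with ⟨l, rfl, rfl⟩ | ⟨l, hl, rfl⟩
    · rw [MvPolynomial.mem_homogeneousSubmodule]
      induction l with
      | nil => exact MvPolynomial.isHomogeneous_one _ _
      | cons i l ih =>
        rw [List.map_cons, List.prod_cons, List.length_cons, add_comm]
        exact (MvPolynomial.isHomogeneous_X _ i).mul ih
    · exact zero_mem _
  | zero => exact zero_mem _
  | add p q _ _ hp hq => exact add_mem hp hq
  | smul c p _ hp => exact Submodule.smul_mem _ c hp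

/-- A monomial in the Dunkl–Heckman operators, for some choice of the order of its factors. -/
def dunklMonomials (k : ℂ) (N : ℕ) : Poly N →ₗ[ℂ] (SymN N →ₗ[ℂ] Poly N) :=
  (MvPolynomial.basisMonomials (Fin N) ℂ).constr ℂ fun s =>
    dunklWord k (Finsupp.toMultiset s).toList

theorem dunklMonomials_prod (k : ℂ) (l : List (Fin N)) :
    dunklWord k l - dunklMonomials k N (l.map MvPolynomial.X).prod ∈ wordSpan k N l.length := by
  have h : (l.map MvPolynomial.X).prod =
      MvPolynomial.monomial (Multiset.toFinsupp (l : Multiset (Fin N))) (1 : ℂ) := by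
    induction l with
    | nil => simp
    | cons i l ih =>
      rw [List.map_cons, List.prod_cons, ih, MvPolynomial.X, MvPolynomial.monomial_mul, one_mul,
        ← Multiset.cons_coe, ← Multiset.singleton_add, map_add, Multiset.toFinsupp_singleton]
  have h2 := (MvPolynomial.basisMonomials (Fin N) ℂ).constr_basis ℂ
    (fun s => dunklWord k (Finsupp.toMultiset s).toList) (Multiset.toFinsupp (l : Multiset (Fin N)))
  rw [MvPolynomial.coe_basisMonomials] at h2
  rw [h, dunklMonomials, h2, Multiset.toFinsupp_toMultiset]
  refine dunklWord_perm k (Multiset.coe_eq_coe.1 ?_)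
  rw [Multiset.coe_toList]

/-- The linear map `dunklMonomials` recovers an operator from its symbol modulo shorter words, for
every pair in the relation. A zero symbol therefore leaves only shorter words. -/
theorem mem_wordSpan_of_symbol_zero {k : ℂ} {n : ℕ} {T : SymN N →ₗ[ℂ] Poly N}
    (hT : (T, 0) ∈ symbolRel k N n) : T ∈ wordSpan k N n := by
  have h : ∀ p ∈ symbolRel k N n, p.1 - dunklMonomials k N p.2 ∈ wordSpan k N n := by
    intro p hp
    induction hp using Submodule.span_induction with
    | mem p h =>
      rcases h with ⟨l, rfl, rfl⟩ | ⟨l, hl, rfl⟩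
      · exact dunklMonomials_prod k l
      · simpa using dunklWord_mem hl
    | zero => simp
    | add p q _ _ hp hq =>
      have := add_mem hp hq
      rwa [sub_add_sub_comm, ← map_add] at this
    | smul c p _ hp =>
      have := Submodule.smul_mem _ c hp
      rwa [smul_sub, ← map_smul] at this
  simpa using h _ hT

theorem symbolRel_dunklHeckman_comp {k : ℂ} {n : ℕ} {p : (SymN N →ₗ[ℂ] Poly N) × Poly N}
    (i : Fin N) (hp : p ∈ symbolRel k N n) :
    ((dunklHeckman k i).comp p.1, MvPolynomial.X i * p.2) ∈ symbolRel k N (n + 1) := by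
  induction hp using Submodule.span_induction with
  | mem p h =>
    rcases h with ⟨l, rfl, rfl⟩ | ⟨l, hl, rfl⟩
    · exact Submodule.subset_span (Or.inl ⟨i :: l, rfl, by simp [dunklWord]⟩)
    · exact Submodule.subset_span (Or.inr ⟨i :: l, by simpa using hl, by simp [dunklWord]⟩)
  | zero =>
    rw [Prod.fst_zero, Prod.snd_zero, LinearMap.comp_zero, mul_zero]
    exact zero_mem _
  | add p q _ _ hp hq =>
    have := add_mem hp hq
    rwa [Prod.mk_add_mk, ← LinearMap.comp_add, ← mul_add] at this
  | smul c p _ hp =>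
    have := Submodule.smul_mem _ c hp
    rwa [Prod.smul_mk, ← LinearMap.comp_smul, ← mul_smul_comm] at this

/-- Since S takes values in Λ_N, composing on the left with a word just prefixes its letters to the
words of S. -/
theorem symbolRel_dunklWord_comp {k : ℂ} {n : ℕ} {S : Module.End ℂ (SymN N)} {Q : Poly N}
    (l : List (Fin N)) (hS : ((symIncl N).comp S, Q) ∈ symbolRel k N n) :
    ((dunklWord k l).comp S, (l.map MvPolynomial.X).prod * Q) ∈ symbolRel k N (l.length + n) := by
  induction l with
  | nil => simpa [dunklWord] using hS
  | cons i l ih =>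
    have := symbolRel_dunklHeckman_comp i ih
    rw [← mul_assoc] at this
    rw [List.length_cons, Nat.succ_add]
    exact this

/-- Symbols are multiplicative. -/
theorem symbolRel_comp {k : ℂ} {m n : ℕ} {p : (SymN N →ₗ[ℂ] Poly N) × Poly N}
    {S : Module.End ℂ (SymN N)} {Q : Poly N} (hp : p ∈ symbolRel k N m)
    (hS : ((symIncl N).comp S, Q) ∈ symbolRel k N n) :
    (p.1.comp S, p.2 * Q) ∈ symbolRel k N (m + n) := by
  induction hp using Submodule.span_induction with
  | mem p h =>
    rcases h with ⟨l, rfl, rfl⟩ | ⟨l, hl, rfl⟩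
    · exact symbolRel_dunklWord_comp l hS
    · rw [zero_mul]
      refine symbolRel_of_mem (wordSpan_mono ?_
        (mem_wordSpan_of_symbolRel (symbolRel_dunklWord_comp l hS)))
      omega
  | zero =>
    rw [Prod.fst_zero, Prod.snd_zero, LinearMap.zero_comp, zero_mul]
    exact zero_mem _
  | add p q _ _ hp hq =>
    have := add_mem hp hq
    rwa [Prod.mk_add_mk, ← LinearMap.add_comp, ← add_mul] at this
  | smul c p _ hp =>
    have := Submodule.smul_mem _ c hp
    rwa [Prod.smul_mk, ← LinearMap.smul_comp, ← smul_mul_assoc] at this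

/-! ### Iterated commutators with symmetric polynomials -/

/-- The commutator of an operator `Λ_N → ℂ[x]` with multiplication by `f`. -/
def symComm (f : SymN N) : Module.End ℂ (SymN N →ₗ[ℂ] Poly N) where
  toFun T := T.comp (LinearMap.mulLeft ℂ f) - (LinearMap.mulLeft ℂ f.1).comp T
  map_add' S T := by rw [LinearMap.add_comp, LinearMap.comp_add]; abel
  map_smul' c T := by
    rw [LinearMap.smul_comp, LinearMap.comp_smul, RingHom.id_apply, smul_sub]

theorem symComm_apply (f : SymN N) (T : SymN N →ₗ[ℂ] Poly N) (g : SymN N) :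
    symComm f T g = T (f * g) - f.1 * T g := rfl

/-- A symmetric factor is fixed by the swap. Consequently only the Euler part of a Dunkl–Heckman
operator contributes to its commutator with f. -/
theorem heckPair_sym_mul (i j : Fin N) (f : SymN N) (g : Poly N) :
    heckPair i j (f.1 * g) = f.1 * heckPair i j g := by
  by_cases h : i = j
  · subst h; simp [heckPair_self]
  apply mul_left_cancel₀ (X_sub_X_ne_zero h)
  have h1 := sub_mul_heckPair i j (f.1 * g)
  have h2 := sub_mul_heckPair i j g
  rw [map_mul (permVar _), permVar_sym] at h1
  linear_combination h1 - f.1 * h2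

theorem dunklHeckman_sym_mul (k : ℂ) (i : Fin N) (f : SymN N) (g : Poly N) :
    dunklHeckman k i (f.1 * g) = f.1 * dunklHeckman k i g + eulerOp i f.1 * g := by
  rw [dunklHeckman_eq]
  simp only [LinearMap.sub_apply, LinearMap.smul_apply, LinearMap.sum_apply, heckPair_sym_mul,
    eulerOp_mul, ← Finset.mul_sum, mul_sub, mul_smul_comm]
  ring

theorem symComm_dunklHeckman_comp (k : ℂ) (i : Fin N) (f : SymN N) (T : SymN N →ₗ[ℂ] Poly N) :
    symComm f ((dunklHeckman k i).comp T) = (dunklHeckman k i).comp (symComm f T) +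
      (LinearMap.mulLeft ℂ (eulerOp i f.1)).comp T := by
  refine LinearMap.ext fun g => ?_
  simp only [symComm_apply, LinearMap.comp_apply, LinearMap.add_apply, LinearMap.mulLeft_apply,
    map_sub, dunklHeckman_sym_mul]
  ring

theorem symComm_mulLeft_comp (h : Poly N) (f : SymN N) (T : SymN N →ₗ[ℂ] Poly N) :
    symComm f ((LinearMap.mulLeft ℂ h).comp T) = (LinearMap.mulLeft ℂ h).comp (symComm f T) := by
  refine LinearMap.ext fun g => ?_
  simp only [symComm_apply, LinearMap.comp_apply, LinearMap.mulLeft_apply]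
  ring

theorem symComm_symIncl (f : SymN N) : symComm f (symIncl N) = 0 := by
  refine LinearMap.ext fun g => ?_
  simp [symComm_apply, symIncl_apply]

/-- This is a Leibniz rule: the commutator of D_{i,N} with f is a multiplication operator, so at
most one of the n + 1 commutators can act on that letter. -/
theorem symComm_pow_dunklHeckman_comp (k : ℂ) (i : Fin N) (f : SymN N) (n : ℕ)
    (T : SymN N →ₗ[ℂ] Poly N) :
    (symComm f ^ (n + 1)) ((dunklHeckman k i).comp T) =
      (dunklHeckman k i).comp ((symComm f ^ (n + 1)) T) +
      (n + 1 : ℂ) • (LinearMap.mulLeft ℂ (eulerOp i f.1)).comp ((symComm f ^ n) T) := by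
  induction n with
  | zero => simp [symComm_dunklHeckman_comp]
  | succ n ih =>
    rw [pow_succ', Module.End.mul_apply, ih, map_add, map_smul, symComm_dunklHeckman_comp,
      symComm_mulLeft_comp, ← Module.End.mul_apply, ← pow_succ', ← Module.End.mul_apply (symComm f),
      ← pow_succ']
    push_cast
    module

/-- Each commutator has to act on a different letter; the factorial counts the ways to assign them.
-/
theorem symComm_pow_dunklWord (k : ℂ) (f : SymN N) (l : List (Fin N)) :
    (symComm f ^ l.length) (dunklWord k l) = (l.length.factorial : ℂ) •
      (LinearMap.mulLeft ℂ ((l.map fun i => eulerOp i f.1).prod)).comp (symIncl N) := by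
  induction l with
  | nil => refine LinearMap.ext fun g => ?_; simp [dunklWord]
  | cons i l ih =>
    have h0 : (symComm f ^ (l.length + 1)) (dunklWord k l) = 0 := by
      rw [pow_succ', Module.End.mul_apply, ih, map_smul, symComm_mulLeft_comp, symComm_symIncl,
        LinearMap.comp_zero, smul_zero]
    rw [List.length_cons, dunklWord, symComm_pow_dunklHeckman_comp, h0, ih, LinearMap.comp_zero,
      zero_add, LinearMap.comp_smul, smul_smul, ← LinearMap.comp_assoc, List.map_cons,
      List.prod_cons, Nat.factorial_succ]
    push_cast
    congr 2
    refine LinearMap.ext fun g => ?_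
    simp

theorem symComm_pow_dunklWord_of_lt (k : ℂ) (f : SymN N) (l : List (Fin N)) {n : ℕ}
    (h : l.length < n) : (symComm f ^ n) (dunklWord k l) = 0 := by
  obtain ⟨m, rfl⟩ := Nat.exists_eq_add_of_lt h
  rw [show l.length + m + 1 = m + 1 + l.length by ring, pow_add, Module.End.mul_apply,
    symComm_pow_dunklWord, map_smul, pow_succ, Module.End.mul_apply, symComm_mulLeft_comp,
    symComm_symIncl, LinearMap.comp_zero, map_zero, smul_zero]

theorem symComm_pow_of_symbolRel {k : ℂ} {n : ℕ} {p : (SymN N →ₗ[ℂ] Poly N) × Poly N}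
    (f : SymN N) (hp : p ∈ symbolRel k N n) :
    (symComm f ^ n) p.1 = (n.factorial : ℂ) •
      (LinearMap.mulLeft ℂ (MvPolynomial.aeval (fun i => eulerOp i f.1) p.2)).comp
        (symIncl N) := by
  induction hp using Submodule.span_induction with
  | mem p h =>
    rcases h with ⟨l, rfl, rfl⟩ | ⟨l, hl, rfl⟩
    · rw [symComm_pow_dunklWord, map_list_prod, List.map_map]
      congr 5
      funext i
      simp
    · rw [symComm_pow_dunklWord_of_lt k f l hl]
      refine LinearMap.ext fun g => ?_
      simp
  | zero => refine LinearMap.ext fun g => ?_; simp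
  | add p q _ _ hp hq =>
    refine LinearMap.ext fun g => ?_
    rw [Prod.fst_add, map_add, hp, hq]
    simp [add_mul]
  | smul c p _ hp =>
    refine LinearMap.ext fun g => ?_
    rw [Prod.smul_fst, map_smul, hp]
    simp only [LinearMap.smul_apply, LinearMap.comp_apply, LinearMap.mulLeft_apply, Prod.smul_snd,
      map_smul, smul_mul_assoc]
    rw [smul_comm]

theorem symComm_symIncl_comp (f : SymN N) (S : Module.End ℂ (SymN N)) :
    symComm f ((symIncl N).comp S) =
      (symIncl N).comp (S * LinearMap.mulLeft ℂ f - LinearMap.mulLeft ℂ f * S) := rfl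

theorem IsDiffOp.symComm_pow_eq_zero {m : ℕ} {S : Module.End ℂ (SymN N)} (hS : IsDiffOp m S)
    (f : SymN N) {n : ℕ} (hn : m < n) : (symComm f ^ n) ((symIncl N).comp S) = 0 := by
  have h : (symComm f ^ (m + 1)) ((symIncl N).comp S) = 0 := by
    clear hn
    induction m generalizing S with
    | zero =>
      rw [zero_add, pow_one]
      refine LinearMap.ext fun g => sub_eq_zero.2 ?_
      exact congrArg Subtype.val (LinearMap.congr_fun (hS f) g)
    | succ m ih => rw [pow_succ, Module.End.mul_apply, symComm_symIncl_comp, ih (hS f)]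
  obtain ⟨d, rfl⟩ := Nat.exists_eq_add_of_lt hn
  rw [show m + d + 1 = d + (m + 1) by ring, pow_add, Module.End.mul_apply, h, map_zero]

end Symbols

/-! ### Power sums -/

section PowerSums

variable {N : ℕ}

/-- The kernels of the iterates stabilize. This is used to obtain the algebraic independence of p_1,
..., p_M in M variables from the fact that they generate. -/
theorem injective_of_surjective_endomorphism {A : Type*} [CommRing A] [IsNoetherianRing A]
    (f : A →+* A) (hf : Function.Surjective f) : Function.Injective f := by
  have hmono : Monotone fun n : ℕ => RingHom.ker (f ^ n) :=
    monotone_nat_of_le_succ fun n x hx => by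
      rw [RingHom.mem_ker] at hx ⊢
      rw [pow_succ', RingHom.mul_def, RingHom.comp_apply, hx, map_zero]
  obtain ⟨n, hn⟩ := monotone_stabilizes_iff_noetherian.2 ‹IsNoetherianRing A› ⟨_, hmono⟩
  rw [injective_iff_map_eq_zero]
  intro x hx
  have hfn : Function.Surjective (f ^ n) := by
    rw [RingHom.coe_pow]
    exact hf.iterate n
  obtain ⟨y, rfl⟩ := hfn x
  have h1 : y ∈ RingHom.ker (f ^ (n + 1)) := by
    rwa [RingHom.mem_ker, pow_succ', RingHom.mul_def, RingHom.comp_apply]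
  have h2 : RingHom.ker (f ^ n) = RingHom.ker (f ^ (n + 1)) := hn (n + 1) (Nat.le_succ n)
  rw [← h2] at h1
  exact h1

/-- Elementary symmetric polynomials are polynomials in power sums of smaller or equal degree. -/
theorem esymm_mem_of_psum_mem {σ : Type*} [Fintype σ] (A : Subalgebra ℂ (MvPolynomial σ ℂ)) (n : ℕ)
    (hA : ∀ a, 0 < a → a ≤ n → MvPolynomial.psum σ ℂ a ∈ A) {j : ℕ} (hj : j ≤ n) :
    MvPolynomial.esymm σ ℂ j ∈ A := by
  induction j using Nat.strong_induction_on with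
  | _ j ih =>
    rcases Nat.eq_zero_or_pos j with rfl | hpos
    · rw [MvPolynomial.esymm_zero]; exact one_mem A
    have h := MvPolynomial.mul_esymm_eq_sum σ ℂ j
    have hmem : (j : MvPolynomial σ ℂ) * MvPolynomial.esymm σ ℂ j ∈ A := by
      rw [h]
      refine mul_mem (pow_mem (neg_mem (one_mem A)) _) (sum_mem fun a ha => ?_)
      rw [Finset.mem_filter, Finset.HasAntidiagonal.mem_antidiagonal] at ha
      exact mul_mem (mul_mem (pow_mem (neg_mem (one_mem A)) _) (ih _ ha.2 (by omega)))
        (hA _ (by omega) (by omega))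
    have h2 : MvPolynomial.esymm σ ℂ j =
        ((j : ℂ)⁻¹) • ((j : MvPolynomial σ ℂ) * MvPolynomial.esymm σ ℂ j) := by
      rw [← map_natCast (MvPolynomial.C : ℂ →+* MvPolynomial σ ℂ), MvPolynomial.C_mul', smul_smul,
        inv_mul_cancel₀ (by exact_mod_cast hpos.ne'), one_smul]
    rw [h2]
    exact A.smul_mem hmem _

theorem phi_X (N : ℕ) (a : ℕ+) :
    (phi N (MvPolynomial.X a) : Poly N) = MvPolynomial.psum (Fin N) ℂ a := by
  simp [phi]

/-- The power sums of degree at most `n` generate the symmetric polynomials in `n` variables. -/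
theorem symmetric_mem_of_psum_mem (A : Subalgebra ℂ (Poly N))
    (hA : ∀ a, 0 < a → a ≤ N → MvPolynomial.psum (Fin N) ℂ a ∈ A) (f : SymN N) : f.1 ∈ A := by
  obtain ⟨P, rfl⟩ := MvPolynomial.esymmAlgHom_surjective (R := ℂ) (σ := Fin N) (n := N) (by simp) f
  induction P using MvPolynomial.induction_on with
  | C a =>
    rw [← MvPolynomial.algebraMap_eq, AlgHom.commutes]
    exact A.algebraMap_mem a
  | add p q hp hq => rw [map_add]; exact add_mem hp hq
  | mul_X p i hp =>
    rw [map_mul]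
    refine mul_mem hp ?_
    simp only [MvPolynomial.esymmAlgHom, MvPolynomial.aeval_X]
    exact esymm_mem_of_psum_mem A N hA i.2

theorem phi_surjective (N : ℕ) : Function.Surjective (phi N) := by
  intro f
  obtain ⟨P, hP⟩ := symmetric_mem_of_psum_mem
    ((MvPolynomial.symmetricSubalgebra (Fin N) ℂ).val.comp (phi N)).range
    (fun a ha _ => ⟨MvPolynomial.X ⟨a, ha⟩, phi_X N ⟨a, ha⟩⟩) f
  exact ⟨P, Subtype.ext hP⟩

theorem symRestrict_phi (N : ℕ) (f : Lam) : symRestrict N (phi (N + 1) f) = phi N f := by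
  have h : (symRestrict N).comp (phi (N + 1)) = phi N := by
    apply MvPolynomial.algHom_ext
    intro a
    apply Subtype.ext
    rw [AlgHom.comp_apply, phi_X]
    change killLast N (phi (N + 1) (MvPolynomial.X a)).1 = _
    rw [phi_X, MvPolynomial.psum, map_sum, Fin.sum_univ_castSucc]
    simp [killLast, MvPolynomial.psum, a.ne_zero]
  exact DFunLike.congr_fun h f

/-- The homomorphisms `φ_N` are jointly injective. -/
theorem eq_zero_of_phi_eq_zero {f : Lam} (hf : ∀ N, phi N f = 0) : f = 0 := by
  obtain ⟨M, hM⟩ : ∃ M : ℕ, ∀ a ∈ f.vars, (a : ℕ) ≤ M :=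
    ⟨f.vars.sup fun a => (a : ℕ), fun a ha => Finset.le_sup (f := fun a : ℕ+ => (a : ℕ)) ha⟩
  -- The element f involves only p_1, ..., p_M, numbered here from 0, and φ_M is already injective
  -- on their polynomials.
  let g : Fin M → ℕ+ := fun i => ⟨i + 1, Nat.succ_pos _⟩
  have hg : Function.Injective g := fun i j h => by
    have := congrArg PNat.val h
    simp only [g, PNat.mk_coe] at this
    exact Fin.ext (by omega)
  obtain ⟨q, rfl⟩ := MvPolynomial.exists_rename_eq_of_vars_subset_range f g hg (by
    intro a ha
    have h1 := hM a ha
    have h2 := a.pos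
    exact ⟨⟨a - 1, by omega⟩, PNat.eq (by simp only [g, PNat.mk_coe]; omega)⟩)
  have hsurj : Function.Surjective ((phi M).comp (MvPolynomial.rename g)) := by
    intro p
    obtain ⟨P, hP⟩ := symmetric_mem_of_psum_mem ((MvPolynomial.symmetricSubalgebra (Fin M) ℂ).val.comp
      ((phi M).comp (MvPolynomial.rename g))).range (fun a ha ha' => by
        refine ⟨MvPolynomial.X ⟨a - 1, by omega⟩, ?_⟩
        change ((phi M (MvPolynomial.rename g _) : SymN M) : Poly M) = _
        rw [MvPolynomial.rename_X, phi_X]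
        simp only [g, PNat.mk_coe]
        rw [Nat.sub_add_cancel ha]) p
    exact ⟨P, Subtype.ext hP⟩
  -- Identifying Λ_M with a polynomial ring in M variables turns the surjection `hsurj` into an
  -- endomorphism of a Noetherian ring.
  let e := MvPolynomial.esymmAlgEquiv (Fin M) ℂ (n := M) (by simp)
  have hinj : Function.Injective (e.symm.toAlgHom.comp ((phi M).comp (MvPolynomial.rename g))) :=
    injective_of_surjective_endomorphism
      (e.symm.toAlgHom.comp ((phi M).comp (MvPolynomial.rename g))).toRingHom
      (e.symm.surjective.comp hsurj)
  have hq : q = 0 := by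
    apply hinj
    rw [map_zero, AlgHom.comp_apply, AlgHom.comp_apply, hf M, map_zero]
  rw [hq, map_zero]

theorem isHomogeneous_psum (n : ℕ) : (MvPolynomial.psum (Fin N) ℂ n).IsHomogeneous n := by
  rw [MvPolynomial.psum]
  refine MvPolynomial.IsHomogeneous.sum _ _ _ fun i _ => ?_
  simpa using (MvPolynomial.isHomogeneous_X ℂ i).pow n

/-- A homogeneous symmetric polynomial is a combination of products of power sums of the same
degree. -/
theorem homogeneous_mem_span_psum {m : ℕ} {Q : Poly N}
    (hQ : Q ∈ MvPolynomial.symmetricSubalgebra (Fin N) ℂ) (hm : Q.IsHomogeneous m) :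
    Q ∈ Submodule.span ℂ {P : Poly N | ∃ l : List ℕ+, (l.map fun a : ℕ+ => (a : ℕ)).sum = m ∧
      P = (l.map fun a : ℕ+ => MvPolynomial.psum (Fin N) ℂ (a : ℕ)).prod} := by
  have hall : ∀ f : Lam, (phi N f).1 ∈ Submodule.span ℂ
      {P : Poly N | ∃ l : List ℕ+, P = (l.map fun a : ℕ+ => MvPolynomial.psum (Fin N) ℂ (a : ℕ)).prod} := by
    intro f
    induction f using MvPolynomial.induction_on with
    | C a =>
      rw [← MvPolynomial.algebraMap_eq, AlgHom.commutes, Algebra.algebraMap_eq_smul_one]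
      exact Submodule.smul_mem _ _ (Submodule.subset_span ⟨[], rfl⟩)
    | add p q hp hq => rw [map_add]; exact add_mem hp hq
    | mul_X p a hp =>
      rw [map_mul, mul_comm]
      change (phi N (MvPolynomial.X a)).1 * (phi N p).1 ∈ _
      rw [phi_X]
      generalize (phi N p).1 = y at hp ⊢
      induction hp using Submodule.span_induction with
      | mem x h =>
        obtain ⟨l, rfl⟩ := h
        exact Submodule.subset_span ⟨a :: l, by simp⟩
      | zero => rw [mul_zero]; exact zero_mem _
      | add x y _ _ hx hy => rw [mul_add]; exact add_mem hx hy
      | smul c x _ hx => rw [mul_smul_comm]; exact Submodule.smul_mem _ c hx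
  obtain ⟨f, hf⟩ := phi_surjective N ⟨Q, hQ⟩
  have h1 := hall f
  rw [hf] at h1
  -- Projecting onto degree m discards the products of power sums of any other degree.
  rw [← MvPolynomial.homogeneousComponent_eq_self hm]
  replace h1 : Q ∈ _ := h1
  clear hm hQ hf
  induction h1 using Submodule.span_induction with
  | mem x h =>
    obtain ⟨l, rfl⟩ := h
    have hl : ((l.map fun a : ℕ+ => MvPolynomial.psum (Fin N) ℂ (a : ℕ)).prod).IsHomogeneous
        (l.map fun a : ℕ+ => (a : ℕ)).sum := by
      induction l with
      | nil => exact MvPolynomial.isHomogeneous_one _ _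
      | cons a l ih =>
        simp only [List.map_cons, List.prod_cons, List.sum_cons]
        exact (isHomogeneous_psum _).mul ih
    rw [MvPolynomial.homogeneousComponent_of_mem hl]
    split_ifs with h
    · exact Submodule.subset_span ⟨l, h.symm, rfl⟩
    · exact zero_mem _
  | zero => rw [map_zero]; exact zero_mem _
  | add x y _ _ hx hy => rw [map_add]; exact add_mem hx hy
  | smul c x _ hx => rw [map_smul]; exact Submodule.smul_mem _ c hx

theorem eulerOp_psum (i : Fin N) (n : ℕ) :
    eulerOp i (MvPolynomial.psum (Fin N) ℂ n) = (n : ℂ) • MvPolynomial.X i ^ n := by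
  rw [MvPolynomial.psum, map_sum, Finset.sum_eq_single i]
  · cases n with
    | zero => simp [eulerOp]
    | succ n =>
      simp [eulerOp, Derivation.leibniz_pow, Algebra.smul_def]
      ring
  · intro j _ hj
    simp [eulerOp, Derivation.leibniz_pow, MvPolynomial.pderiv_X_of_ne hj]
  · simp

/-- A polynomial is determined by its values at the gradients `(x_i ∂f/∂x_i)_i` of symmetric `f`. -/
theorem eq_zero_of_aeval_eulerOp {Q : Poly N}
    (hQ : ∀ f : SymN N, MvPolynomial.aeval (fun i => eulerOp i f.1) Q = 0) : Q = 0 := by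
  refine MvPolynomial.funext fun v => ?_
  -- The points must be distinct for interpolation and nonzero for division. Given a target v, the
  -- interpolating g has x_i g(x_i) = v_i, and f is chosen so that x_i ∂f/∂x_i = x_i g(x_i), whence
  -- Q(v) = 0.
  let x : Fin N → ℂ := fun i => (i : ℂ) + 1
  have hx0 : ∀ i, x i ≠ 0 := fun i => Nat.cast_add_one_ne_zero _
  have hx : Set.InjOn x (Finset.univ : Finset (Fin N)) := fun i _ j _ h => by
    simp only [x, add_left_inj, Nat.cast_inj] at h
    exact Fin.ext h
  let g := Lagrange.interpolate Finset.univ x fun i => v i / x i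
  have hg : ∀ i, g.eval (x i) = v i / x i := fun i =>
    Lagrange.eval_interpolate_at_node _ hx (Finset.mem_univ i)
  let f : SymN N := ∑ a ∈ Finset.range (g.natDegree + 1), (g.coeff a / (a + 1 : ℂ)) •
    (⟨MvPolynomial.psum (Fin N) ℂ (a + 1), MvPolynomial.psum_isSymmetric (Fin N) ℂ _⟩ : SymN N)
  have hf : ∀ i, eulerOp i f.1 =
      ∑ a ∈ Finset.range (g.natDegree + 1), g.coeff a • MvPolynomial.X i ^ (a + 1) := by
    intro i
    have : f.1 = ∑ a ∈ Finset.range (g.natDegree + 1), (g.coeff a / (a + 1 : ℂ)) •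
        MvPolynomial.psum (Fin N) ℂ (a + 1) := by
      simp only [f, AddSubmonoidClass.coe_finsetSum]
      rfl
    rw [this, map_sum]
    refine Finset.sum_congr rfl fun a _ => ?_
    rw [map_smul, eulerOp_psum, smul_smul]
    push_cast
    rw [div_mul_cancel₀ _ (Nat.cast_add_one_ne_zero a)]
  have hv : ∀ i, MvPolynomial.aeval x (eulerOp i f.1) = v i := by
    intro i
    rw [hf, map_sum]
    simp only [map_smul, pow_succ, smul_eq_mul]
    simp only [map_mul, map_pow, MvPolynomial.aeval_X, ← mul_assoc]
    rw [← Finset.sum_mul, ← Polynomial.eval_eq_sum_range, hg, div_mul_cancel₀ _ (hx0 i)]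
  have h := congrArg (MvPolynomial.aeval x) (hQ f)
  rw [MvPolynomial.comp_aeval_apply, map_zero, funext hv] at h
  rw [map_zero, ← h, MvPolynomial.aeval_eq_eval]

/-- Permuting the variables permutes the components x_i ∂f/∂x_i of a symmetric f. So Q and its
permuted copy agree at all these vectors, which determine a polynomial. -/
theorem symmetric_of_aeval_eulerOp {Q : Poly N}
    (hQ : ∀ f : SymN N, MvPolynomial.aeval (fun i => eulerOp i f.1) Q ∈
      MvPolynomial.symmetricSubalgebra (Fin N) ℂ) :
    Q ∈ MvPolynomial.symmetricSubalgebra (Fin N) ℂ := by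
  rw [MvPolynomial.mem_symmetricSubalgebra]
  intro e
  rw [← sub_eq_zero]
  refine eq_zero_of_aeval_eulerOp fun f => ?_
  rw [map_sub, sub_eq_zero, MvPolynomial.aeval_rename]
  have h := (MvPolynomial.mem_symmetricSubalgebra _).1 (hQ f) e
  rw [← h]
  change _ = permVar e _
  rw [MvPolynomial.comp_aeval_apply]
  congr 2
  funext i
  rw [← permVar_eulerOp, permVar_sym]
  rfl

end PowerSums

/-! ### Operators on `Λ[x]` -/

section LamX

variable {R : Type} [CommRing R]

/-- The algebra `Λ_R[x]`. -/
abbrev LamX (R : Type) [CommRing R] : Type := Polynomial (LamP R)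

/-- The power sum `p_n ∈ Λ_R` for `n ≥ 0`, where `p_0` is the parameter. -/
def psumVar (p₀ : R) : ℕ → LamP R
  | 0 => MvPolynomial.C p₀
  | n + 1 => MvPolynomial.X n.succPNat

/-- The inclusion of `Λ_R` into `Λ_R[x]`. -/
def constX : LamP R →ₗ[LamP R] LamX R := Polynomial.monomial 0

theorem constX_apply (f : LamP R) : constX f = Polynomial.C f := rfl

/-- The derivation `Λ_R → Λ_R[x]` with `p_a ↦ a x^a`. -/
def dPos : Derivation R (LamP R) (LamX R) :=
  MvPolynomial.mkDerivation R fun a => ((a : ℕ) : LamX R) * Polynomial.X ^ (a : ℕ)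

theorem dPos_X (a : ℕ+) :
    dPos (MvPolynomial.X a : LamP R) = ((a : ℕ) : LamX R) * Polynomial.X ^ (a : ℕ) :=
  MvPolynomial.mkDerivation_X _ _ _

/-- The differentiation of `Λ_R[x]` with `x ↦ x`, `p_a ↦ a x^a`. -/
def delX : Module.End R (LamX R) :=
  Polynomial.lsum fun l => (LinearMap.mulRight R (Polynomial.X ^ l : LamX R)).comp dPos.toLinearMap +
    (LinearMap.mulRight R ((l : LamX R) * Polynomial.X ^ l)).comp (constX.restrictScalars R)

theorem delX_apply (f : LamP R) (l : ℕ) :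
    delX (Polynomial.C f * Polynomial.X ^ l) = dPos f * Polynomial.X ^ l +
      (l : LamX R) * (Polynomial.C f * Polynomial.X ^ l) := by
  rw [Polynomial.C_mul_X_pow_eq_monomial, delX, Polynomial.lsum_apply,
    Polynomial.sum_monomial_index _ _ (by simp), ← Polynomial.C_mul_X_pow_eq_monomial]
  simp [constX_apply]
  ring

theorem delX_C_mul (f : LamP R) (g : LamX R) :
    delX (Polynomial.C f * g) = Polynomial.C f * delX g + dPos f * g := by
  induction g using Polynomial.induction_on' with
  | add p q hp hq => rw [mul_add, map_add, hp, hq, map_add]; ring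
  | monomial l a =>
    rw [← Polynomial.C_mul_X_pow_eq_monomial, ← mul_assoc, ← Polynomial.C_mul, delX_apply,
      delX_apply, Derivation.leibniz, ← Polynomial.C_mul', ← Polynomial.C_mul', Polynomial.C_mul]
    ring

/-- The operator `x^l ↦ p_l`. -/
def evalX (p₀ : R) : LamX R →ₗ[LamP R] LamP R :=
  Polynomial.lsum fun l => LinearMap.mulRight (LamP R) (psumVar p₀ l)

theorem evalX_apply (p₀ : R) (f : LamP R) (l : ℕ) :
    evalX p₀ (Polynomial.C f * Polynomial.X ^ l) = f * psumVar p₀ l := by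
  rw [Polynomial.C_mul_X_pow_eq_monomial, evalX, Polynomial.lsum_apply,
    Polynomial.sum_monomial_index _ _ (by simp)]
  rfl

theorem evalX_C_mul (p₀ : R) (f : LamP R) (g : LamX R) :
    evalX p₀ (Polynomial.C f * g) = f * evalX p₀ g := by
  rw [Polynomial.C_mul', map_smul, smul_eq_mul]

/-- The parameter enters only through the image of x^0. -/
theorem evalX_eq (p₀ : R) (g : LamX R) :
    evalX p₀ g = evalX 0 g + MvPolynomial.C p₀ * g.coeff 0 := by
  induction g using Polynomial.induction_on' with
  | add p q hp hq => rw [map_add, hp, hq, map_add, Polynomial.coeff_add]; ring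
  | monomial l a =>
    rw [← Polynomial.C_mul_X_pow_eq_monomial, evalX_apply, evalX_apply]
    cases l with
    | zero => simp [psumVar, mul_comm]
    | succ l => simp [psumVar]

/-- The element `x^{l-1} p_1 + ⋯ + p_l - l x^l`. -/
def shiftSum (l : ℕ) : LamX R :=
  ∑ m ∈ Finset.range l, Polynomial.C (psumVar 0 (m + 1)) * Polynomial.X ^ (l - 1 - m) -
    (l : LamX R) * Polynomial.X ^ l

/-- The `Λ_R`-linear operator `x^l ↦ x^{l-1} p_1 + ⋯ + p_l - l x^l`. -/
def shiftX : LamX R →ₗ[LamP R] LamX R :=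
  Polynomial.lsum fun l => (LinearMap.mulRight (LamP R) (shiftSum l)).comp constX

theorem shiftX_apply (f : LamP R) (l : ℕ) :
    shiftX (Polynomial.C f * Polynomial.X ^ l) = Polynomial.C f * shiftSum l := by
  rw [Polynomial.C_mul_X_pow_eq_monomial, shiftX, Polynomial.lsum_apply,
    Polynomial.sum_monomial_index _ _ (by simp)]
  rfl

theorem shiftX_C_mul (f : LamP R) (g : LamX R) :
    shiftX (Polynomial.C f * g) = Polynomial.C f * shiftX g := by
  rw [Polynomial.C_mul', map_smul, Polynomial.C_mul']

theorem coeff_zero_shiftX (g : LamX R) : (shiftX g).coeff 0 = evalX 0 g := by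
  induction g using Polynomial.induction_on' with
  | add p q hp hq => rw [map_add, map_add, Polynomial.coeff_add, hp, hq]
  | monomial l a =>
    rw [← Polynomial.C_mul_X_pow_eq_monomial, shiftX_apply, evalX_apply, Polynomial.coeff_C_mul]
    congr 1
    cases l with
    | zero => simp [shiftSum, psumVar]
    | succ l =>
      rw [shiftSum, Finset.sum_range_succ, Polynomial.coeff_sub, Polynomial.coeff_add,
        Polynomial.finsetSum_coeff, Finset.sum_eq_zero]
      · simp
      · intro m hm
        have : l + 1 - 1 - m ≠ 0 := by have := Finset.mem_range.1 hm; omega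
        rw [Polynomial.coeff_C_mul, Polynomial.coeff_X_pow, if_neg this.symm, mul_zero]

theorem coeff_zero_dPos (f : LamP R) : (dPos f).coeff 0 = 0 := by
  induction f using MvPolynomial.induction_on with
  | C a => rw [MvPolynomial.derivation_C]; rfl
  | add p q hp hq => rw [map_add, Polynomial.coeff_add, hp, hq, add_zero]
  | mul_X p a hp =>
    rw [Derivation.leibniz, Polynomial.coeff_add, Polynomial.coeff_smul, Polynomial.coeff_smul, hp,
      dPos_X]
    simp [Polynomial.coeff_X_pow, a.ne_zero.symm]

theorem coeff_zero_delX (g : LamX R) : (delX g).coeff 0 = 0 := by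
  induction g using Polynomial.induction_on' with
  | add p q hp hq => rw [map_add, Polynomial.coeff_add, hp, hq, add_zero]
  | monomial l a =>
    rw [← Polynomial.C_mul_X_pow_eq_monomial, delX_apply, Polynomial.coeff_add,
      Polynomial.mul_coeff_zero, coeff_zero_dPos]
    cases l <;> simp

/-! ### Comparison with the Laurent version -/

/-- The inclusion `Λ_R[x] → Λ^±_R[x, x⁻¹]`. -/
def toLaur : LamX R →+* LaurX R :=
  Polynomial.eval₂RingHom (LaurentPolynomial.C.comp (incl (R := R)).toRingHom)
    (LaurentPolynomial.T 1)

theorem toLaur_C (f : LamP R) : toLaur (Polynomial.C f) = LaurentPolynomial.C (incl f) := by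
  simp [toLaur]

theorem toLaur_X_pow (l : ℕ) :
    toLaur (Polynomial.X ^ l : LamX R) = LaurentPolynomial.T (l : ℤ) := by
  simp [toLaur, LaurentPolynomial.T_pow]

theorem toLaur_C_mul_X_pow (f : LamP R) (l : ℕ) : toLaur (Polynomial.C f * Polynomial.X ^ l) =
    LaurentPolynomial.C (incl f) * LaurentPolynomial.T (l : ℤ) := by
  rw [map_mul, toLaur_C, toLaur_X_pow]

theorem toLaur_smul (c : R) (g : LamX R) : toLaur (c • g) = c • toLaur g := by
  have h1 : c • g = Polynomial.C (MvPolynomial.C c) * g := by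
    rw [Polynomial.C_mul', ← MvPolynomial.algebraMap_eq, algebraMap_smul]
  have h2 : c • toLaur g = LaurentPolynomial.C (MvPolynomial.C c) * toLaur g := by
    rw [← LaurentPolynomial.smul_eq_C_mul, ← MvPolynomial.algebraMap_eq, algebraMap_smul]
  rw [h1, h2, map_mul, toLaur_C]
  simp [incl]

theorem incl_psumVar (p₀ : R) (n : ℕ) : incl (psumVar p₀ n) = pw p₀ (n : ℤ) := by
  cases n with
  | zero => simp [psumVar, incl, pw]
  | succ n =>
    have h : ((n + 1 : ℕ) : ℤ) ≠ 0 := by omega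
    rw [pw, dif_pos h]
    exact MvPolynomial.rename_X _ _

theorem toLaur_dPos (f : LamP R) : toLaur (dPos f) = dP (incl f) := by
  induction f using MvPolynomial.induction_on with
  | C a =>
    have : incl (MvPolynomial.C a) = algebraMap R (LaurP R) a := (incl (R := R)).commutes a
    rw [MvPolynomial.derivation_C, this, Derivation.map_algebraMap, map_zero]
  | add p q hp hq => simp only [map_add, hp, hq]
  | mul_X p a hp =>
    have hX : dP (incl (MvPolynomial.X a : LamP R)) =
        ((a : ℕ) : ℤ) • LaurentPolynomial.T ((a : ℕ) : ℤ) := by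
      simp [incl, dP, MvPolynomial.mkDerivation_X]
    rw [Derivation.leibniz, map_add, map_mul, Derivation.leibniz, hX, dPos_X,
      ← Polynomial.C_mul', ← Polynomial.C_mul', map_mul, map_mul, map_mul, toLaur_C, toLaur_C,
      toLaur_X_pow, hp, LaurentPolynomial.smul_eq_C_mul, LaurentPolynomial.smul_eq_C_mul]
    simp

/-- Doubling `shiftSum` counts p_l twice, which the last term corrects; for l = 0 the two parameter
terms cancel. -/
theorem deltaT_eq (p₀ : R) (l : ℕ) : deltaT p₀ (l : ℤ) =
    toLaur (2 * shiftSum l + p₀ • Polynomial.X ^ l - Polynomial.C (psumVar p₀ l)) := by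
  have hp : p₀ • (LaurentPolynomial.T (l : ℤ) : LaurX R) =
      LaurentPolynomial.C (pw p₀ 0) * LaurentPolynomial.T (l : ℤ) := by
    rw [← LaurentPolynomial.smul_eq_C_mul, pw, dif_neg (by simp), ← MvPolynomial.algebraMap_eq,
      algebraMap_smul]
  rw [map_sub, map_add, map_mul, map_ofNat, toLaur_smul, toLaur_X_pow, toLaur_C, incl_psumVar, hp]
  cases l with
  | zero => simp [deltaT, shiftSum]
  | succ n =>
    have hs : ((n + 1 : ℕ) : ℤ).sign = 1 := Int.sign_eq_one_of_pos (by omega)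
    have hsum : ∀ m ∈ Finset.range n, toLaur (Polynomial.C (psumVar (0 : R) (m + 1)) *
        Polynomial.X ^ (n + 1 - 1 - m)) =
        LaurentPolynomial.C (pw p₀ (1 * ((1 + m : ℕ) : ℤ))) *
          LaurentPolynomial.T (1 * (((n + 1 : ℕ) : ℤ) - ((1 + m : ℕ) : ℤ))) := by
      intro m hm
      have := Finset.mem_range.1 hm
      have e : psumVar (0 : R) (m + 1) = psumVar p₀ (m + 1) := rfl
      rw [toLaur_C_mul_X_pow, e, incl_psumVar]
      congr 3 <;> omega
    have e : psumVar (0 : R) (n + 1) = psumVar p₀ (n + 1) := rfl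
    rw [deltaT, hs, one_smul, Int.natAbs_natCast, deltaAux, shiftSum, map_sub, map_sum,
      Finset.sum_range_succ, Finset.sum_congr rfl hsum, toLaur_C_mul_X_pow,
      Finset.sum_Ico_eq_sum_range, map_mul, map_natCast, toLaur_X_pow, e, incl_psumVar]
    simp only [Nat.add_sub_cancel, Nat.sub_self, Nat.cast_zero, LaurentPolynomial.T_zero, one_mul,
      mul_one, zsmul_eq_mul]
    push_cast
    ring

theorem toLaur_delX (g : LamX R) : toLaur (delX g) = del (toLaur g) := by
  induction g using Polynomial.induction_on' with
  | add p q hp hq => simp only [map_add, hp, hq]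
  | monomial l a =>
    rw [← Polynomial.C_mul_X_pow_eq_monomial, toLaur_C_mul_X_pow, del_apply, delX_apply, map_add,
      map_mul, toLaur_X_pow, toLaur_dPos, map_mul, map_natCast, toLaur_C_mul_X_pow]
    simp

theorem toLaur_delta (p₀ : R) (g : LamX R) :
    toLaur (2 * shiftX g + p₀ • g - Polynomial.C (evalX p₀ g)) = delta p₀ (toLaur g) := by
  induction g using Polynomial.induction_on' with
  | add p q hp hq =>
    rw [map_add toLaur, map_add (delta p₀), ← hp, ← hq, ← map_add]
    congr 1
    simp only [map_add, smul_add]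
    ring
  | monomial l a =>
    rw [← Polynomial.C_mul_X_pow_eq_monomial, toLaur_C_mul_X_pow, delta_apply, deltaT_eq,
      ← toLaur_C, ← map_mul, shiftX_apply, evalX_apply]
    congr 1
    rw [mul_sub, mul_add, Polynomial.C_mul, mul_smul_comm]
    ring

theorem evalE_toLaur (p₀ : R) (g : LamX R) : evalE p₀ (toLaur g) = incl (evalX p₀ g) := by
  induction g using Polynomial.induction_on' with
  | add p q hp hq => simp only [map_add, hp, hq]
  | monomial l a =>
    rw [← Polynomial.C_mul_X_pow_eq_monomial, toLaur_C_mul_X_pow, evalE, laurLift_apply,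
      evalX_apply, map_mul, incl_psumVar]
    rfl

variable [Algebra ℂ R]

/-- The operator `∂ - k Δ` with `Δ = shiftX`, which does not involve the parameter `p₀`. -/
def dunklFree (k : ℂ) : Module.End R (LamX R) :=
  delX - algebraMap ℂ R k • shiftX.restrictScalars R

theorem dunklFree_apply (k : ℂ) (g : LamX R) :
    dunklFree k g = delX g - algebraMap ℂ R k • shiftX g := rfl

theorem dunklFree_C_mul (k : ℂ) (f : LamP R) (g : LamX R) :
    dunklFree k (Polynomial.C f * g) = Polynomial.C f * dunklFree k g + dPos f * g := by
  rw [dunklFree_apply, dunklFree_apply, delX_C_mul, shiftX_C_mul, mul_sub, mul_smul_comm]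
  ring

/-- The derivation ∂ produces no constant term, and the constant term of `shiftSum l` is p_l. This
trades the constant term of one power of the operator for E_0 of the preceding power. -/
theorem coeff_zero_dunklFree (k : ℂ) (g : LamX R) :
    (dunklFree k g).coeff 0 = -(algebraMap ℂ R k • evalX 0 g) := by
  rw [dunklFree_apply, Polynomial.coeff_sub, coeff_zero_delX, Polynomial.coeff_smul,
    coeff_zero_shiftX, zero_sub]

/-- The infinite-dimensional Dunkl–Heckman operator on `Λ_R[x]`. -/
def dunklX (p₀ : R) (k : ℂ) : Module.End R (LamX R) :=
  dunklFree k - (algebraMap ℂ R (k / 2) * p₀) • 1 + algebraMap ℂ R (k / 2) •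
    (constX.restrictScalars R).comp ((evalX p₀).restrictScalars R)

theorem dunklX_apply (p₀ : R) (k : ℂ) (g : LamX R) :
    dunklX p₀ k g = delX g - algebraMap ℂ R (k / 2) •
      ((2 : LamX R) * shiftX g + p₀ • g - Polynomial.C (evalX p₀ g)) := by
  have h : algebraMap ℂ R k = 2 * algebraMap ℂ R (k / 2) := by
    rw [← map_ofNat (algebraMap ℂ R) 2, ← map_mul]
    congr 1
    ring
  have h2 : (2 : LamX R) * shiftX g = (2 : R) • shiftX g := by
    rw [two_mul, two_smul]
  rw [h2]
  simp only [dunklX, LinearMap.add_apply, LinearMap.sub_apply, dunklFree_apply,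
    LinearMap.smul_apply, Module.End.one_apply, LinearMap.comp_apply, LinearMap.restrictScalars_apply,
    constX_apply, h]
  module

theorem toLaur_dunklX (p₀ : R) (k : ℂ) (g : LamX R) :
    toLaur (dunklX p₀ k g) = dunklInf p₀ k (toLaur g) := by
  rw [dunklX_apply, map_sub, toLaur_smul, toLaur_delX, toLaur_delta]
  rfl

theorem laurentIntegralRes_apply (p₀ : R) (k : ℂ) (r : ℕ) (f : LamP R) :
    laurentIntegralRes p₀ k r f = evalX p₀ ((dunklX p₀ k ^ r) (Polynomial.C f)) := by
  have h : ∀ g : LamX R, (dunklInf p₀ k ^ r) (toLaur g) = toLaur ((dunklX p₀ k ^ r) g) := by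
    intro g
    induction r with
    | zero => rfl
    | succ r ih => rw [pow_succ', pow_succ', Module.End.mul_apply, Module.End.mul_apply, ih,
        toLaur_dunklX]
  apply incl_injective
  rw [incl_laurentIntegralRes, ← evalE_toLaur, ← h, toLaur_C, ← LaurentPolynomial.single_eq_C]
  rfl

end LamX

/-! ### Generators of the algebra of Laurent CMS integrals that do not involve `p₀` -/

section Generators

/-- If `D'` and `D` differ by a scalar and a multiple of `C ∘ E`, then the operators `E D'^r C` are
polynomials in the operators `E D^s C`. -/
theorem comp_pow_comp_mem_adjoin {R V W : Type*} [CommRing R] [AddCommGroup V] [Module R V]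
    [AddCommGroup W] [Module R W] (E : V →ₗ[R] W) (C : W →ₗ[R] V) {D D' : Module.End R V} (a b : R)
    (h : D' = D + a • 1 + b • C.comp E) (r : ℕ) :
    (E.comp ((D' ^ r).comp C) : Module.End R W) ∈
      Algebra.adjoin R (Set.range fun s => (E.comp ((D ^ s).comp C) : Module.End R W)) := by
  set A := Algebra.adjoin R (Set.range fun s => (E.comp ((D ^ s).comp C) : Module.End R W))
  -- `V₀` is stable under D by construction. It is stable under C ∘ E because E maps it into `A`, so
  -- that C ∘ E lands in the terms with s = 0. Hence it is stable under D'.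
  let V₀ : Submodule R (W →ₗ[R] V) :=
    Submodule.span R {T | ∃ (s : ℕ) (X : Module.End R W), X ∈ A ∧ T = ((D ^ s).comp C).comp X}
  have hE : ∀ T ∈ V₀, (E.comp T : Module.End R W) ∈ A := by
    intro T hT
    induction hT using Submodule.span_induction with
    | mem T hT =>
      obtain ⟨s, X, hX, rfl⟩ := hT
      have hs : (E.comp ((D ^ s).comp C) : Module.End R W) ∈ A := Algebra.subset_adjoin ⟨s, rfl⟩
      exact mul_mem hs hX
    | zero => rw [LinearMap.comp_zero]; exact zero_mem A
    | add S T _ _ hS hT => rw [LinearMap.comp_add]; exact add_mem hS hT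
    | smul c T _ hT => rw [LinearMap.comp_smul]; exact A.smul_mem hT c
  have hD : ∀ T ∈ V₀, D.comp T ∈ V₀ := by
    intro T hT
    induction hT using Submodule.span_induction with
    | mem T hT =>
      obtain ⟨s, X, hX, rfl⟩ := hT
      refine Submodule.subset_span ⟨s + 1, X, hX, ?_⟩
      rw [pow_succ']
      rfl
    | zero => rw [LinearMap.comp_zero]; exact zero_mem _
    | add S T _ _ hS hT => rw [LinearMap.comp_add]; exact add_mem hS hT
    | smul c T _ hT => rw [LinearMap.comp_smul]; exact Submodule.smul_mem _ c hT
  have hD' : ∀ T ∈ V₀, D'.comp T ∈ V₀ := by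
    intro T hT
    have : D'.comp T = D.comp T + a • T + b • C.comp (E.comp T) := by
      rw [h]
      refine LinearMap.ext fun w => ?_
      simp
    rw [this]
    exact add_mem (add_mem (hD T hT) (Submodule.smul_mem _ _ hT))
      (Submodule.smul_mem _ _ (Submodule.subset_span ⟨0, _, hE T hT, by rw [pow_zero]; rfl⟩))
  refine hE _ ?_
  induction r with
  | zero => exact Submodule.subset_span ⟨0, 1, one_mem A, rfl⟩
  | succ r ih =>
    rw [pow_succ']
    exact hD' _ ih

variable {R : Type} [CommRing R] [Algebra ℂ R]

/-- The operator `E_{p₀} ∘ (∂ - k Δ)^r` on `Λ_R`. -/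
def freeEval (p₀ : R) (k : ℂ) (r : ℕ) : Module.End R (LamP R) :=
  ((evalX p₀).restrictScalars R).comp ((dunklFree k ^ r).comp (constX.restrictScalars R))

theorem freeEval_apply (p₀ : R) (k : ℂ) (r : ℕ) (f : LamP R) :
    freeEval p₀ k r f = evalX p₀ ((dunklFree k ^ r) (Polynomial.C f)) := rfl

variable (R) in
/-- The generators of the algebra of Laurent CMS integrals that do not involve `p₀`. -/
def freeIntegral (k : ℂ) (r : ℕ) : Module.End R (LamP R) := freeEval (0 : R) k r

theorem freeIntegral_apply (k : ℂ) (r : ℕ) (f : LamP R) :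
    freeIntegral R k r f = evalX 0 ((dunklFree k ^ r) (Polynomial.C f)) := rfl

theorem laurentIntegralRes_eq (p₀ : R) (k : ℂ) (r : ℕ) : laurentIntegralRes p₀ k r =
    ((evalX p₀).restrictScalars R).comp ((dunklX p₀ k ^ r).comp (constX.restrictScalars R)) :=
  LinearMap.ext fun f => laurentIntegralRes_apply p₀ k r f

/-- The perturbation argument applies in both directions, with opposite coefficients. -/
theorem laurentAlgebra_eq_adjoin_freeEval (p₀ : R) (k : ℂ) :
    laurentAlgebra p₀ k = Algebra.adjoin R (Set.range (freeEval p₀ k)) := by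
  apply le_antisymm
  · refine Algebra.adjoin_le ?_
    rintro _ ⟨r, rfl⟩
    rw [laurentIntegralRes_eq]
    refine comp_pow_comp_mem_adjoin _ _ (-(algebraMap ℂ R (k / 2) * p₀)) (algebraMap ℂ R (k / 2)) ?_ r
    rw [dunklX]
    module
  · refine Algebra.adjoin_le ?_
    rintro _ ⟨r, rfl⟩
    rw [laurentAlgebra, show laurentIntegralRes p₀ k = fun s => ((evalX p₀).restrictScalars R).comp
      ((dunklX p₀ k ^ s).comp (constX.restrictScalars R)) from
        funext fun s => laurentIntegralRes_eq p₀ k s]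
    refine comp_pow_comp_mem_adjoin _ _ (algebraMap ℂ R (k / 2) * p₀) (-algebraMap ℂ R (k / 2)) ?_ r
    rw [dunklX]
    module

theorem freeIntegral_zero (k : ℂ) : freeIntegral R k 0 = 0 := by
  refine LinearMap.ext fun f => ?_
  rw [freeIntegral_apply, pow_zero, Module.End.one_apply, ← mul_one (Polynomial.C f),
    ← pow_zero Polynomial.X, evalX_apply]
  simp [psumVar]

theorem freeEval_zero (p₀ : R) (k : ℂ) : freeEval p₀ k 0 = algebraMap R _ p₀ := by
  refine LinearMap.ext fun f => ?_
  rw [freeEval_apply, pow_zero, Module.End.one_apply, ← mul_one (Polynomial.C f),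
    ← pow_zero Polynomial.X, evalX_apply, Module.algebraMap_end_apply, psumVar, mul_comm,
    MvPolynomial.C_mul']

/-- The correction is p_0 times the constant term of the last power, given by
`coeff_zero_dunklFree`. Being triangular in r, the relation can be inverted. -/
theorem freeEval_succ (p₀ : R) (k : ℂ) (r : ℕ) : freeEval p₀ k (r + 1) =
    freeIntegral R k (r + 1) - (p₀ * algebraMap ℂ R k) • freeIntegral R k r := by
  refine LinearMap.ext fun f => ?_
  rw [freeEval_apply, evalX_eq, pow_succ', Module.End.mul_apply, coeff_zero_dunklFree,
    LinearMap.sub_apply, LinearMap.smul_apply, freeIntegral_apply, freeIntegral_apply, pow_succ',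
    Module.End.mul_apply, MvPolynomial.C_mul', smul_neg, smul_smul, sub_eq_add_neg]

/-- The algebra of Laurent CMS integrals has generators which do not involve `p₀`. -/
theorem laurentAlgebra_eq (p₀ : R) (k : ℂ) :
    laurentAlgebra p₀ k = Algebra.adjoin R (Set.range (freeIntegral R k)) := by
  rw [laurentAlgebra_eq_adjoin_freeEval]
  apply le_antisymm
  · refine Algebra.adjoin_le ?_
    rintro _ ⟨r, rfl⟩
    cases r with
    | zero => rw [freeEval_zero]; exact Subalgebra.algebraMap_mem _ _
    | succ r =>
      rw [freeEval_succ]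
      have h : ∀ s, freeIntegral R k s ∈ Algebra.adjoin R (Set.range (freeIntegral R k)) :=
        fun s => Algebra.subset_adjoin ⟨s, rfl⟩
      exact sub_mem (h _) (Subalgebra.smul_mem _ (h _) _)
  · refine Algebra.adjoin_le ?_
    rintro _ ⟨r, rfl⟩
    induction r with
    | zero => rw [freeIntegral_zero]; exact zero_mem _
    | succ r ih =>
      have h := freeEval_succ p₀ k r
      rw [eq_sub_iff_add_eq] at h
      rw [← h]
      exact add_mem (Algebra.subset_adjoin ⟨_, rfl⟩) (Subalgebra.smul_mem _ ih _)

/-! ### Extension of scalars -/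

/-- The inclusion `Λ → Λ_R`. -/
def lamMap (R : Type) [CommRing R] [Algebra ℂ R] : Lam →+* LamP R :=
  MvPolynomial.map (algebraMap ℂ R)

theorem extendOp_lamMap (D : Module.End ℂ Lam) (f : Lam) :
    extendOp (R := R) D (lamMap R f) = lamMap R (D f) := by
  have h : ∀ g : Lam, MvPolynomial.algebraTensorAlgEquiv (σ := ℕ+) ℂ R (1 ⊗ₜ g) = lamMap R g := by
    intro g
    simp [lamMap]
  have h' : (MvPolynomial.algebraTensorAlgEquiv (σ := ℕ+) ℂ R).symm (lamMap R f) = 1 ⊗ₜ f := by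
    rw [AlgEquiv.symm_apply_eq, h]
  change MvPolynomial.algebraTensorAlgEquiv (σ := ℕ+) ℂ R (LinearMap.baseChange R D
    ((MvPolynomial.algebraTensorAlgEquiv (σ := ℕ+) ℂ R).symm (lamMap R f))) = _
  rw [h', LinearMap.baseChange_tmul, h]

/-- The monomials with coefficient 1 come from `Λ` and span over R. -/
theorem lamP_hom_ext {M : Type*} [AddCommGroup M] [Module R M] {S T : LamP R →ₗ[R] M}
    (h : ∀ f : Lam, S (lamMap R f) = T (lamMap R f)) : S = T := by
  refine (MvPolynomial.basisMonomials ℕ+ R).ext fun s => ?_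
  have := h (MvPolynomial.monomial s 1)
  rw [lamMap, MvPolynomial.map_monomial, map_one] at this
  simpa using this

/-- The inclusion `Λ[x] → Λ_R[x]`. -/
def lamXMap (R : Type) [CommRing R] [Algebra ℂ R] : LamX ℂ →+* LamX R :=
  Polynomial.mapRingHom (lamMap R)

theorem lamXMap_C_mul_X_pow (f : Lam) (l : ℕ) : lamXMap R (Polynomial.C f * Polynomial.X ^ l) =
    Polynomial.C (lamMap R f) * Polynomial.X ^ l := by
  simp [lamXMap]

theorem lamXMap_C (f : Lam) : lamXMap R (Polynomial.C f) = Polynomial.C (lamMap R f) := by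
  simp [lamXMap]

theorem lamXMap_X_pow (l : ℕ) : lamXMap R (Polynomial.X ^ l) = Polynomial.X ^ l := by
  simp [lamXMap]

theorem lamMap_psumVar (n : ℕ) : lamMap R (psumVar 0 n) = psumVar 0 n := by
  cases n <;> simp [psumVar, lamMap]

theorem lamXMap_dPos (f : Lam) : lamXMap R (dPos f) = dPos (lamMap R f) := by
  induction f using MvPolynomial.induction_on with
  | C a => simp [lamMap, MvPolynomial.derivation_C]
  | add p q hp hq => simp only [map_add, hp, hq]
  | mul_X p a hp =>
    have hX : lamMap R (MvPolynomial.X a) = MvPolynomial.X a := by simp [lamMap]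
    rw [map_mul (lamMap R), Derivation.leibniz, Derivation.leibniz, ← Polynomial.C_mul', ← Polynomial.C_mul',
      ← Polynomial.C_mul', ← Polynomial.C_mul', map_add, map_mul, map_mul, hp, lamXMap_C, lamXMap_C,
      hX, dPos_X, dPos_X, map_mul, map_natCast, lamXMap_X_pow]

theorem lamXMap_delX (g : LamX ℂ) : lamXMap R (delX g) = delX (lamXMap R g) := by
  induction g using Polynomial.induction_on' with
  | add p q hp hq => simp only [map_add, hp, hq]
  | monomial l a =>
    rw [← Polynomial.C_mul_X_pow_eq_monomial, lamXMap_C_mul_X_pow, delX_apply, delX_apply, map_add,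
      map_mul, map_mul, lamXMap_dPos, map_natCast, lamXMap_C_mul_X_pow, lamXMap_X_pow]

theorem lamXMap_shiftSum (l : ℕ) : lamXMap R (shiftSum l) = shiftSum l := by
  rw [shiftSum, map_sub, map_sum, map_mul, map_natCast, lamXMap_X_pow, shiftSum]
  simp only [lamXMap_C_mul_X_pow, lamMap_psumVar]

theorem lamXMap_shiftX (g : LamX ℂ) : lamXMap R (shiftX g) = shiftX (lamXMap R g) := by
  induction g using Polynomial.induction_on' with
  | add p q hp hq => simp only [map_add, hp, hq]
  | monomial l a =>
    rw [← Polynomial.C_mul_X_pow_eq_monomial, lamXMap_C_mul_X_pow, shiftX_apply, shiftX_apply,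
      map_mul, lamXMap_C, lamXMap_shiftSum]

theorem lamXMap_smul (c : ℂ) (g : LamX ℂ) :
    lamXMap R (c • g) = algebraMap ℂ R c • lamXMap R g := by
  have h1 : c • g = Polynomial.C (MvPolynomial.C c) * g := by
    rw [Polynomial.C_mul', ← MvPolynomial.algebraMap_eq, algebraMap_smul]
  have h2 : algebraMap ℂ R c • lamXMap R g =
      Polynomial.C (MvPolynomial.C (algebraMap ℂ R c)) * lamXMap R g := by
    rw [Polynomial.C_mul', ← MvPolynomial.algebraMap_eq]
    exact (algebraMap_smul (LamP R) (algebraMap ℂ R c) (lamXMap R g)).symm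
  rw [h1, h2, map_mul, lamXMap_C]
  simp [lamMap]

theorem lamXMap_dunklFree (k : ℂ) (g : LamX ℂ) :
    lamXMap R (dunklFree k g) = dunklFree k (lamXMap R g) := by
  rw [dunklFree_apply, dunklFree_apply, map_sub, lamXMap_smul, lamXMap_delX, lamXMap_shiftX]
  rfl

theorem lamMap_evalX (g : LamX ℂ) : lamMap R (evalX 0 g) = evalX 0 (lamXMap R g) := by
  induction g using Polynomial.induction_on' with
  | add p q hp hq => simp only [map_add, hp, hq]
  | monomial l a =>
    rw [← Polynomial.C_mul_X_pow_eq_monomial, lamXMap_C_mul_X_pow, evalX_apply, evalX_apply,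
      map_mul, lamMap_psumVar]

theorem extendOp_freeIntegral (k : ℂ) (r : ℕ) :
    extendOp (R := R) (freeIntegral ℂ k r) = freeIntegral R k r := by
  refine lamP_hom_ext fun f => ?_
  rw [extendOp_lamMap, freeIntegral_apply, freeIntegral_apply, lamMap_evalX, ← lamXMap_C]
  congr 1
  generalize (Polynomial.C f : LamX ℂ) = g
  induction r with
  | zero => rfl
  | succ r ih => rw [pow_succ', pow_succ', Module.End.mul_apply, Module.End.mul_apply, ← ih,
      lamXMap_dunklFree]

end Generators

/-! ### Specialization to finitely many variables -/

section Specialization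

variable {N : ℕ}

/-- The homomorphism `Λ[x] → ℂ[x₁, …, x_N]` extending `φ_N` by `x ↦ x_i`. -/
def phiX (i : Fin N) : LamX ℂ →+* Poly N :=
  Polynomial.eval₂RingHom ((MvPolynomial.symmetricSubalgebra (Fin N) ℂ).val.comp (phi N)).toRingHom
    (MvPolynomial.X i)

theorem phiX_C (i : Fin N) (f : Lam) : phiX i (Polynomial.C f) = (phi N f).1 := by
  simp [phiX]

theorem phiX_X (i : Fin N) : phiX i Polynomial.X = MvPolynomial.X i := by
  simp [phiX]

theorem phiX_smul (i : Fin N) (c : ℂ) (g : LamX ℂ) : phiX i (c • g) = c • phiX i g := by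
  have h1 : c • g = Polynomial.C (MvPolynomial.C c) * g := by
    rw [Polynomial.C_mul', ← MvPolynomial.algebraMap_eq, algebraMap_smul]
  rw [h1, map_mul, phiX_C, ← MvPolynomial.algebraMap_eq, AlgHom.commutes, Algebra.smul_def]
  rfl

theorem phi_psumVar (n : ℕ) :
    (phi N (psumVar (N : ℂ) n) : Poly N) = MvPolynomial.psum (Fin N) ℂ n := by
  cases n with
  | zero =>
    rw [psumVar, ← MvPolynomial.algebraMap_eq, AlgHom.commutes]
    simp
  | succ n => exact phi_X N n.succPNat

theorem phiX_dPos (i : Fin N) (f : Lam) : phiX i (dPos f) = eulerOp i (phi N f).1 := by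
  induction f using MvPolynomial.induction_on with
  | C a =>
    rw [MvPolynomial.derivation_C, map_zero, ← MvPolynomial.algebraMap_eq, AlgHom.commutes]
    simp [eulerOp]
  | add p q hp hq =>
    rw [map_add, map_add, hp, hq, map_add (phi N), ← map_add]
    rfl
  | mul_X p a hp =>
    have h : (phi N (p * MvPolynomial.X a)).1 = (phi N p).1 * MvPolynomial.psum (Fin N) ℂ a := by
      rw [map_mul (phi N), ← phi_X]
      rfl
    rw [h, eulerOp_mul, eulerOp_psum, Derivation.leibniz, dPos_X, ← Polynomial.C_mul',
      ← Polynomial.C_mul', map_add, map_mul, map_mul, map_mul, hp, phiX_C, phiX_C, phi_X, map_pow,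
      phiX_X, map_natCast, Algebra.smul_def, map_natCast]
    ring

theorem phiX_delX (i : Fin N) (g : LamX ℂ) : phiX i (delX g) = eulerOp i (phiX i g) := by
  induction g using Polynomial.induction_on' with
  | add p q hp hq => simp only [map_add, hp, hq]
  | monomial l a =>
    have hX : eulerOp i (MvPolynomial.X i ^ l : Poly N) = (l : Poly N) * MvPolynomial.X i ^ l := by
      cases l with
      | zero => simp [eulerOp]
      | succ l =>
        simp [eulerOp, Derivation.leibniz_pow]
        ring
    rw [← Polynomial.C_mul_X_pow_eq_monomial, delX_apply, map_add, map_mul, map_mul, map_mul,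
      map_pow, phiX_dPos, phiX_C, phiX_X, map_natCast, eulerOp_mul, hX]
    ring

theorem phi_evalX (g : LamX ℂ) : (phi N (evalX (N : ℂ) g)).1 = ∑ i : Fin N, phiX i g := by
  induction g using Polynomial.induction_on' with
  | add p q hp hq =>
    simp only [map_add (phiX _), Finset.sum_add_distrib, ← hp, ← hq]
    rw [map_add, map_add]
    rfl
  | monomial l a =>
    rw [← Polynomial.C_mul_X_pow_eq_monomial, evalX_apply, map_mul]
    simp only [map_mul (phiX _), map_pow, phiX_C, phiX_X, ← Finset.mul_sum]
    change (phi N a).1 * (phi N (psumVar (N : ℂ) l)).1 = _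
    rw [phi_psumVar]
    rfl

theorem heckPair_X_pow {i j : Fin N} (h : i ≠ j) (l : ℕ) :
    heckPair i j (MvPolynomial.X i ^ l : Poly N) =
      2 * (MvPolynomial.X j * ∑ m ∈ Finset.range l,
        MvPolynomial.X j ^ m * MvPolynomial.X i ^ (l - 1 - m)) +
      MvPolynomial.X i ^ l - MvPolynomial.X j ^ l := by
  apply mul_left_cancel₀ (X_sub_X_ne_zero h)
  have h1 := sub_mul_heckPair i j (MvPolynomial.X i ^ l : Poly N)
  have h2 := geom_sum₂_mul (MvPolynomial.X j : Poly N) (MvPolynomial.X i) l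
  rw [map_pow (permVar _), permVar_X, Equiv.swap_apply_left] at h1
  linear_combination h1 + 2 * MvPolynomial.X j * h2

theorem sum_heckPair_X_pow (i : Fin N) (l : ℕ) :
    ∑ j, heckPair i j (MvPolynomial.X i ^ l : Poly N) =
      phiX i (2 * shiftSum l + (N : ℂ) • Polynomial.X ^ l -
        Polynomial.C (psumVar (N : ℂ) l)) := by
  -- Extending the off-diagonal formula to j = i would give 2 l x_i^l instead of 0. Subtracting it
  -- accounts for the term -2 l x^l of Δ, and the N copies of x_i^l account for p_0 = N.
  have h : ∀ j, heckPair i j (MvPolynomial.X i ^ l : Poly N) =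
      2 * (MvPolynomial.X j * ∑ m ∈ Finset.range l,
        MvPolynomial.X j ^ m * MvPolynomial.X i ^ (l - 1 - m)) +
      MvPolynomial.X i ^ l - MvPolynomial.X j ^ l -
      if j = i then 2 * (l : Poly N) * MvPolynomial.X i ^ l else 0 := by
    intro j
    split_ifs with hj
    · subst hj
      have h1 : ∀ m ∈ Finset.range l, (MvPolynomial.X j : Poly N) *
          (MvPolynomial.X j ^ m * MvPolynomial.X j ^ (l - 1 - m)) = MvPolynomial.X j ^ l := by
        intro m hm
        rw [← pow_add, ← pow_succ']
        congr 1
        have := Finset.mem_range.1 hm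
        omega
      rw [heckPair_self, Finset.mul_sum, Finset.sum_congr rfl h1]
      simp
      ring
    · rw [heckPair_X_pow (Ne.symm hj), sub_zero]
  have hs : ∑ j, (MvPolynomial.X j : Poly N) * ∑ m ∈ Finset.range l,
      MvPolynomial.X j ^ m * MvPolynomial.X i ^ (l - 1 - m) =
      ∑ m ∈ Finset.range l, MvPolynomial.psum (Fin N) ℂ (m + 1) *
        MvPolynomial.X i ^ (l - 1 - m) := by
    simp only [MvPolynomial.psum, Finset.sum_mul, Finset.mul_sum]
    rw [Finset.sum_comm]
    refine Finset.sum_congr rfl fun m _ => Finset.sum_congr rfl fun j _ => ?_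
    ring
  have hp : ∀ m : ℕ, (phi N (psumVar (0 : ℂ) (m + 1)) : Poly N) =
      MvPolynomial.psum (Fin N) ℂ (m + 1) := fun m => phi_psumVar (m + 1)
  rw [Finset.sum_congr rfl fun j _ => h j, Finset.sum_sub_distrib, Finset.sum_sub_distrib,
    Finset.sum_add_distrib, ← Finset.mul_sum, hs, Finset.sum_ite_eq', if_pos (Finset.mem_univ i),
    map_sub, map_add, map_mul, phiX_C, phi_psumVar, shiftSum, map_sub, map_sum, phiX_smul]
  have hl : ∑ j, (MvPolynomial.X j : Poly N) ^ l = MvPolynomial.psum (Fin N) ℂ l := rfl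
  simp only [map_mul, map_pow, phiX_C, phiX_X, hp, map_natCast, map_ofNat, hl, Finset.sum_const,
    Finset.card_univ, Fintype.card_fin, nsmul_eq_mul, MvPolynomial.smul_eq_C_mul]
  ring

theorem sum_heckPair_phiX (i : Fin N) (g : LamX ℂ) :
    ∑ j, heckPair i j (phiX i g) =
      phiX i (2 * shiftX g + (N : ℂ) • g - Polynomial.C (evalX (N : ℂ) g)) := by
  induction g using Polynomial.induction_on' with
  | add p q hp hq =>
    simp only [map_add (phiX i), map_add (heckPair _ _), Finset.sum_add_distrib]
    rw [hp, hq, ← map_add]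
    congr 1
    simp only [map_add, smul_add]
    ring
  | monomial l a =>
    rw [← Polynomial.C_mul_X_pow_eq_monomial, map_mul, map_pow, phiX_C, phiX_X]
    simp only [heckPair_sym_mul, ← Finset.mul_sum]
    rw [sum_heckPair_X_pow, ← phiX_C, ← map_mul, shiftX_apply, evalX_apply]
    congr 1
    rw [mul_sub, mul_add, Polynomial.C_mul, mul_smul_comm]
    ring

/-- This is the bridge between the two constructions; summing over i then corresponds to E at p_0 =
N. -/
theorem phiX_dunklX (k : ℂ) (i : Fin N) (g : LamX ℂ) :
    phiX i (dunklX (N : ℂ) k g) = dunklHeckman k i (phiX i g) := by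
  rw [dunklX_apply, map_sub, phiX_smul, phiX_delX, ← sum_heckPair_phiX, dunklHeckman_eq]
  simp

/-- The specialization of the Laurent CMS integral at `p₀ = N` is the CMS integral in `N`
variables. -/
theorem phi_laurentIntegralRes (k : ℂ) (N r : ℕ) (f : Lam) :
    phi N (laurentIntegralRes (N : ℂ) k r f) = cmsIntegral k N r (phi N f) := by
  apply Subtype.ext
  rw [laurentIntegralRes_apply, phi_evalX]
  change _ = (∑ i : Fin N, dunklHeckman k i ^ r) (phi N f).1
  rw [LinearMap.sum_apply]
  refine Finset.sum_congr rfl fun i _ => ?_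
  rw [← phiX_C i]
  generalize (Polynomial.C f : LamX ℂ) = g
  induction r with
  | zero => rfl
  | succ r ih => rw [pow_succ', pow_succ', Module.End.mul_apply, Module.End.mul_apply, ← ih,
      phiX_dunklX]

/-! ### Operators on `Λ` and the operators they induce on `Λ_N` -/

/-- The operator `D` on `Λ` induces the operator `S` on `Λ_N`. -/
def Induces (D : Module.End ℂ Lam) (S : Module.End ℂ (SymN N)) : Prop :=
  ∀ f, phi N (D f) = S (phi N f)

theorem Induces.mul {D E : Module.End ℂ Lam} {S T : Module.End ℂ (SymN N)} (h : Induces D S)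
    (h' : Induces E T) : Induces (D * E) (S * T) := fun f => by
  rw [Module.End.mul_apply, h, h', Module.End.mul_apply]

theorem Induces.add {D E : Module.End ℂ Lam} {S T : Module.End ℂ (SymN N)} (h : Induces D S)
    (h' : Induces E T) : Induces (D + E) (S + T) := fun f => by
  rw [LinearMap.add_apply, map_add, h, h', LinearMap.add_apply]

theorem Induces.sub {D E : Module.End ℂ Lam} {S T : Module.End ℂ (SymN N)} (h : Induces D S)
    (h' : Induces E T) : Induces (D - E) (S - T) := fun f => by
  rw [LinearMap.sub_apply, map_sub, h, h', LinearMap.sub_apply]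

theorem Induces.smul {D : Module.End ℂ Lam} {S : Module.End ℂ (SymN N)} (c : ℂ) (h : Induces D S) :
    Induces (c • D) (c • S) := fun f => by
  rw [LinearMap.smul_apply, map_smul, h, LinearMap.smul_apply]

theorem Induces.unique {D : Module.End ℂ Lam} {S T : Module.End ℂ (SymN N)} (h : Induces D S)
    (h' : Induces D T) : S = T := by
  refine LinearMap.ext fun g => ?_
  obtain ⟨f, rfl⟩ := phi_surjective N g
  rw [← h, h']

theorem induces_algebraMap (c : ℂ) :
    Induces (N := N) (algebraMap ℂ _ c) (algebraMap ℂ _ c) := fun f => by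
  rw [Module.algebraMap_end_apply, Module.algebraMap_end_apply, map_smul]

theorem exists_induces (k : ℂ) (N : ℕ) {D : Module.End ℂ Lam}
    (hD : D ∈ laurentAlgebra (N : ℂ) k) : ∃ S ∈ cmsAlgebra k N, Induces D S := by
  induction hD using Algebra.adjoin_induction with
  | mem D h =>
    obtain ⟨r, rfl⟩ := h
    exact ⟨_, Algebra.subset_adjoin ⟨r, rfl⟩, phi_laurentIntegralRes k N r⟩
  | algebraMap c => exact ⟨_, Subalgebra.algebraMap_mem _ c, induces_algebraMap c⟩
  | add D E _ _ hD hE =>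
    obtain ⟨S, hS, h⟩ := hD
    obtain ⟨T, hT, h'⟩ := hE
    exact ⟨_, add_mem hS hT, h.add h'⟩
  | mul D E _ _ hD hE =>
    obtain ⟨S, hS, h⟩ := hD
    obtain ⟨T, hT, h'⟩ := hE
    exact ⟨_, mul_mem hS hT, h.mul h'⟩

/-! ### Orders and symbols of the stable generators -/

/-- The commutator of an operator `Λ → Λ[x]` with multiplication by `f ∈ Λ`. -/
def lamComm (f : Lam) : Module.End ℂ (Lam →ₗ[ℂ] LamX ℂ) where
  toFun T := T.comp (LinearMap.mulLeft ℂ f) - (LinearMap.mulLeft ℂ (Polynomial.C f)).comp T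
  map_add' S T := by rw [LinearMap.add_comp, LinearMap.comp_add]; abel
  map_smul' c T := by
    refine LinearMap.ext fun g => ?_
    simp [smul_sub]

theorem lamComm_apply (f : Lam) (T : Lam →ₗ[ℂ] LamX ℂ) (g : Lam) :
    lamComm f T g = T (f * g) - Polynomial.C f * T g := rfl

theorem lamComm_mulLeft_comp (h : LamX ℂ) (f : Lam) (T : Lam →ₗ[ℂ] LamX ℂ) :
    lamComm f ((LinearMap.mulLeft ℂ h).comp T) = (LinearMap.mulLeft ℂ h).comp (lamComm f T) := by
  refine LinearMap.ext fun g => ?_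
  simp only [lamComm_apply, LinearMap.comp_apply, LinearMap.mulLeft_apply]
  ring

theorem lamComm_dunklFree_comp (k : ℂ) (f : Lam) (T : Lam →ₗ[ℂ] LamX ℂ) :
    lamComm f ((dunklFree k).comp T) = (dunklFree k).comp (lamComm f T) +
      (LinearMap.mulLeft ℂ (dPos f)).comp T := by
  refine LinearMap.ext fun g => ?_
  simp only [lamComm_apply, LinearMap.comp_apply, LinearMap.add_apply, LinearMap.mulLeft_apply,
    map_sub, dunklFree_C_mul]
  ring

/-- Differential operators `Λ → Λ[x]` of bounded order over `Λ`. -/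
def IsDiffOpX : ℕ → (Lam →ₗ[ℂ] LamX ℂ) → Prop
  | 0, T => ∀ f, lamComm f T = 0
  | m + 1, T => ∀ f, IsDiffOpX m (lamComm f T)

theorem IsDiffOpX.add {m : ℕ} {S T : Lam →ₗ[ℂ] LamX ℂ} (hS : IsDiffOpX m S) (hT : IsDiffOpX m T) :
    IsDiffOpX m (S + T) := by
  induction m generalizing S T with
  | zero => intro f; rw [map_add, hS f, hT f, add_zero]
  | succ m ih => intro f; rw [map_add]; exact ih (hS f) (hT f)

theorem IsDiffOpX.mulLeft_comp {m : ℕ} {T : Lam →ₗ[ℂ] LamX ℂ} (h : LamX ℂ) (hT : IsDiffOpX m T) :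
    IsDiffOpX m ((LinearMap.mulLeft ℂ h).comp T) := by
  induction m generalizing T with
  | zero => intro f; rw [lamComm_mulLeft_comp, hT f, LinearMap.comp_zero]
  | succ m ih => intro f; rw [lamComm_mulLeft_comp]; exact ih (hT f)

/-- The operator Δ' is `Λ`-linear, so the commutator of ∂ - kΔ' with f is multiplication by `dPos
f`. -/
theorem IsDiffOpX.dunklFree_comp {m : ℕ} {T : Lam →ₗ[ℂ] LamX ℂ} (k : ℂ) (hT : IsDiffOpX m T) :
    IsDiffOpX (m + 1) ((dunklFree k).comp T) := by
  induction m generalizing T with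
  | zero =>
    intro f
    rw [lamComm_dunklFree_comp, hT f, LinearMap.comp_zero, zero_add]
    exact IsDiffOpX.mulLeft_comp (m := 0) _ hT
  | succ m ih =>
    intro f
    rw [lamComm_dunklFree_comp]
    exact (ih (hT f)).add (hT.mulLeft_comp _)

/-- The powers of `∂ - k Δ` restricted to `Λ`. -/
def freePow (k : ℂ) (r : ℕ) : Lam →ₗ[ℂ] LamX ℂ :=
  (dunklFree (R := ℂ) k ^ r).comp (constX.restrictScalars ℂ)

theorem freePow_succ (k : ℂ) (r : ℕ) : freePow k (r + 1) = (dunklFree k).comp (freePow k r) := by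
  rw [freePow, freePow, pow_succ', Module.End.mul_eq_comp, LinearMap.comp_assoc]

theorem lamComm_freePow_zero (k : ℂ) (f : Lam) : lamComm f (freePow k 0) = 0 :=
  LinearMap.ext fun _ => sub_eq_zero.2 Polynomial.C_mul

theorem isDiffOpX_freePow (k : ℂ) (r : ℕ) : IsDiffOpX r (freePow k r) := by
  induction r with
  | zero => exact lamComm_freePow_zero k
  | succ r ih => rw [freePow_succ]; exact ih.dunklFree_comp k

theorem lamComm_pow_dunklFree_comp (k : ℂ) (f : Lam) (n : ℕ) (T : Lam →ₗ[ℂ] LamX ℂ) :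
    (lamComm f ^ (n + 1)) ((dunklFree k).comp T) = (dunklFree k).comp ((lamComm f ^ (n + 1)) T) +
      (n + 1 : ℂ) • (LinearMap.mulLeft ℂ (dPos f)).comp ((lamComm f ^ n) T) := by
  induction n with
  | zero => simp [lamComm_dunklFree_comp]
  | succ n ih =>
    rw [pow_succ', Module.End.mul_apply, ih, map_add, map_smul, lamComm_dunklFree_comp,
      lamComm_mulLeft_comp, ← Module.End.mul_apply, ← pow_succ', ← Module.End.mul_apply (lamComm f),
      ← pow_succ']
    rw [Nat.cast_succ, add_smul ((n : ℂ) + 1) 1, one_smul, add_assoc]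
    congr 1
    exact add_comm _ _

theorem lamComm_pow_freePow (k : ℂ) (f : Lam) (r : ℕ) : (lamComm f ^ r) (freePow k r) =
    (r.factorial : ℂ) • (LinearMap.mulLeft ℂ (dPos f ^ r)).comp (freePow k 0) := by
  induction r with
  | zero => refine LinearMap.ext fun _ => ?_; simp
  | succ r ih =>
    have h0 : (lamComm f ^ (r + 1)) (freePow k r) = 0 := by
      rw [pow_succ', Module.End.mul_apply, ih, map_smul, lamComm_mulLeft_comp,
        lamComm_freePow_zero, LinearMap.comp_zero, smul_zero]
    rw [freePow_succ, lamComm_pow_dunklFree_comp, h0, ih, LinearMap.comp_zero, zero_add,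
      LinearMap.comp_smul, smul_smul, ← LinearMap.comp_assoc, Nat.factorial_succ]
    push_cast
    congr 2
    refine LinearMap.ext fun g => ?_
    simp only [LinearMap.comp_apply, LinearMap.mulLeft_apply]
    ring

/-- E_0 is `Λ`-linear and φ_N multiplicative, so commutators can be computed in `Λ[x]` before
specializing. Orders and symbols are transferred to Λ_N in this way. -/
theorem lamComm_compat {T : Lam →ₗ[ℂ] LamX ℂ} {S : SymN N →ₗ[ℂ] Poly N}
    (h : ∀ g, (phi N (evalX 0 (T g))).1 = S (phi N g)) (f g : Lam) :
    (phi N (evalX 0 (lamComm f T g))).1 = symComm (phi N f) S (phi N g) := by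
  rw [lamComm_apply, symComm_apply, map_sub, evalX_C_mul, map_sub, ← map_mul, ← h, ← h,
    map_mul (phi N) f]
  rfl

theorem lamComm_pow_compat {T : Lam →ₗ[ℂ] LamX ℂ} {S : SymN N →ₗ[ℂ] Poly N}
    (h : ∀ g, (phi N (evalX 0 (T g))).1 = S (phi N g)) (f : Lam) (n : ℕ) (g : Lam) :
    (phi N (evalX 0 ((lamComm f ^ n) T g))).1 = (symComm (phi N f) ^ n) S (phi N g) := by
  induction n generalizing g with
  | zero => exact h g
  | succ n ih =>
    rw [pow_succ', pow_succ', Module.End.mul_apply, Module.End.mul_apply]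
    exact lamComm_compat ih f g

theorem isDiffOp_of_isDiffOpX {m : ℕ} {T : Lam →ₗ[ℂ] LamX ℂ} {S : Module.End ℂ (SymN N)}
    (h : ∀ g, (phi N (evalX 0 (T g))).1 = (symIncl N).comp S (phi N g)) (hT : IsDiffOpX m T) :
    IsDiffOp m S := by
  induction m generalizing S T with
  | zero =>
    intro f
    obtain ⟨f, rfl⟩ := phi_surjective N f
    refine LinearMap.ext fun g => ?_
    obtain ⟨g, rfl⟩ := phi_surjective N g
    have h1 := lamComm_compat h f g
    rw [hT f, LinearMap.zero_apply, map_zero, map_zero] at h1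
    exact Subtype.ext (sub_eq_zero.1 h1.symm)
  | succ m ih =>
    intro f
    obtain ⟨f, rfl⟩ := phi_surjective N f
    exact ih (fun g => lamComm_compat h f g) (hT f)

/-- The bound r does not depend on N, as the inverse limit requires. -/
theorem isDiffOp_of_induces_freeIntegral {k : ℂ} {r : ℕ} {S : Module.End ℂ (SymN N)}
    (h : Induces (freeIntegral ℂ k r) S) : IsDiffOp r S :=
  isDiffOp_of_isDiffOpX (T := freePow k r) (fun g => congrArg Subtype.val (h g))
    (isDiffOpX_freePow k r)

theorem symComm_pow_of_induces_freeIntegral {k : ℂ} {r : ℕ} (hr : 0 < r)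
    {S : Module.End ℂ (SymN N)} (h : Induces (freeIntegral ℂ k r) S) (f : SymN N) :
    (symComm f ^ r) ((symIncl N).comp S) 1 =
      (r.factorial : ℂ) • ∑ i, (eulerOp i f.1) ^ r := by
  obtain ⟨f, rfl⟩ := phi_surjective N f
  have h1 := lamComm_pow_compat (T := freePow k r) (S := (symIncl N).comp S)
    (fun g => congrArg Subtype.val (h g)) f r 1
  rw [map_one (phi N), lamComm_pow_freePow] at h1
  rw [← h1]
  -- Because r > 0 there is no constant term, so E_0 may be replaced by E_N, which specializes to
  -- the sum over all x_i.
  have h2 : (dPos f ^ r).coeff 0 = 0 := by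
    rw [Polynomial.coeff_zero_eq_eval_zero, Polynomial.eval_pow,
      ← Polynomial.coeff_zero_eq_eval_zero, coeff_zero_dPos, zero_pow hr.ne']
  have h3 : ((r.factorial : ℂ) • (LinearMap.mulLeft ℂ (dPos f ^ r)).comp (freePow k 0)) (1 : Lam) =
      (r.factorial : ℂ) • (dPos f ^ r) := by
    simp [freePow, constX_apply]
  have h4 := evalX_eq (N : ℂ) (dPos f ^ r)
  rw [h2, mul_zero, add_zero] at h4
  have h5 : evalX (0 : ℂ) ((r.factorial : ℂ) • (dPos f ^ r)) =
      (r.factorial : ℂ) • evalX (N : ℂ) (dPos f ^ r) := by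
    rw [h4]
    exact ((evalX (0 : ℂ)).restrictScalars ℂ).map_smul _ _
  rw [h3, h5, map_smul]
  change (r.factorial : ℂ) • (phi N _).1 = _
  rw [phi_evalX]
  simp only [map_pow, phiX_dPos]

/-- The generator lies in the Laurent algebra for every value of the parameter, in particular for
p_0 = N. -/
theorem exists_induces_freeIntegral (k : ℂ) (N r : ℕ) :
    ∃ S ∈ cmsAlgebra k N, Induces (freeIntegral ℂ k r) S := by
  apply exists_induces
  rw [laurentAlgebra_eq]
  exact Algebra.subset_adjoin ⟨r, rfl⟩

/-- Compatibility is automatic, since all the S_N are induced by one operator and φ_{N+1} is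
surjective. -/
theorem freeIntegral_mem_stableOps (k : ℂ) (r : ℕ) : freeIntegral ℂ k r ∈ stableOps k := by
  choose S hS hS' using fun N => exists_induces_freeIntegral k N r
  refine ⟨S, ⟨hS, fun N f => ?_, r, fun N => isDiffOp_of_induces_freeIntegral (hS' N)⟩,
    fun N f => hS' N f⟩
  obtain ⟨f, rfl⟩ := phi_surjective (N + 1) f
  rw [← hS', symRestrict_phi, symRestrict_phi, hS']

end Specialization

/-! ### The stable algebra is generated by the stable generators -/

section StableGenerators

variable {N : ℕ}

theorem dunklHeckman_pow_comp_mem {k : ℂ} {n : ℕ} {T : SymN N →ₗ[ℂ] Poly N} (i : Fin N) (r : ℕ)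
    (hT : T ∈ wordSpan k N n) : (dunklHeckman k i ^ r).comp T ∈ wordSpan k N (n + r) := by
  induction r with
  | zero => exact hT
  | succ r ih =>
    rw [pow_succ', Module.End.mul_eq_comp, LinearMap.comp_assoc]
    exact dunklHeckman_comp_mem i ih

theorem symIncl_comp_cmsIntegral_mul (k : ℂ) (r : ℕ) (T : Module.End ℂ (SymN N)) :
    (symIncl N).comp (cmsIntegral k N r * T) =
      ∑ i, (dunklHeckman k i ^ r).comp ((symIncl N).comp T) := by
  refine LinearMap.ext fun f => ?_
  change (∑ i, dunklHeckman k i ^ r) (T f).1 = _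
  rw [LinearMap.sum_apply, LinearMap.sum_apply]
  rfl

theorem exists_mem_wordSpan {k : ℂ} {S : Module.End ℂ (SymN N)} (hS : S ∈ cmsAlgebra k N) :
    ∃ n, (symIncl N).comp S ∈ wordSpan k N n := by
  -- The induction over products needs this stronger form: left multiplication by S lengthens words
  -- by a bounded amount. The case T = 1 gives the claim.
  have h : ∃ w, ∀ (n : ℕ) (T : Module.End ℂ (SymN N)), (symIncl N).comp T ∈ wordSpan k N n →
      (symIncl N).comp (S * T) ∈ wordSpan k N (n + w) := by
    induction hS using Algebra.adjoin_induction with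
    | mem S h =>
      obtain ⟨r, rfl⟩ := h
      refine ⟨r, fun n T hT => ?_⟩
      rw [symIncl_comp_cmsIntegral_mul]
      exact sum_mem fun i _ => dunklHeckman_pow_comp_mem i r hT
    | algebraMap c =>
      refine ⟨0, fun n T hT => ?_⟩
      rw [← Algebra.smul_def, LinearMap.comp_smul]
      exact Submodule.smul_mem _ c hT
    | add S S' _ _ hS hS' =>
      obtain ⟨w, hw⟩ := hS
      obtain ⟨w', hw'⟩ := hS'
      refine ⟨w + w', fun n T hT => ?_⟩
      rw [add_mul, LinearMap.comp_add]
      exact add_mem (wordSpan_mono (by omega) (hw n T hT)) (wordSpan_mono (by omega) (hw' n T hT))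
    | mul S S' _ _ hS hS' =>
      obtain ⟨w, hw⟩ := hS
      obtain ⟨w', hw'⟩ := hS'
      refine ⟨w' + w, fun n T hT => ?_⟩
      rw [mul_assoc, ← add_assoc]
      exact hw _ _ (hw' n T hT)
  obtain ⟨w, hw⟩ := h
  have := hw 1 1 (dunklWord_mem (l := []) Nat.one_pos)
  rw [mul_one] at this
  exact ⟨_, this⟩

theorem aeval_eulerOp_symbol {k : ℂ} {n : ℕ} {T : SymN N →ₗ[ℂ] Poly N} {Q : Poly N}
    (h : (T, Q) ∈ symbolRel k N n) (f : SymN N) : (symComm f ^ n) T 1 =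
      (n.factorial : ℂ) • MvPolynomial.aeval (fun i => eulerOp i f.1) Q := by
  have := LinearMap.congr_fun (symComm_pow_of_symbolRel f h) 1
  simpa [symIncl_apply] using this

theorem symbol_unique {k : ℂ} {n : ℕ} {T : SymN N →ₗ[ℂ] Poly N} {Q Q' : Poly N}
    (h : (T, Q) ∈ symbolRel k N n) (hQ' : ∀ f : SymN N, (symComm f ^ n) T 1 =
      (n.factorial : ℂ) • MvPolynomial.aeval (fun i => eulerOp i f.1) Q') : Q = Q' := by
  rw [← sub_eq_zero]
  refine eq_zero_of_aeval_eulerOp fun f => ?_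
  have h1 := hQ' f
  rw [aeval_eulerOp_symbol h] at h1
  rw [map_sub, sub_eq_zero]
  exact smul_right_injective _ (Nat.cast_ne_zero.2 n.factorial_ne_zero) h1

/-- An operator of order at most `m` is a combination of words of length at most `m`. -/
theorem IsDiffOp.mem_wordSpan {k : ℂ} {m n : ℕ} {S : Module.End ℂ (SymN N)} (hS : IsDiffOp m S)
    (hn : (symIncl N).comp S ∈ wordSpan k N n) : (symIncl N).comp S ∈ wordSpan k N (m + 1) := by
  induction n with
  | zero => exact wordSpan_mono (Nat.zero_le _) hn
  | succ n ih =>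
    rcases Nat.lt_or_ge m n with hmn | hmn
    · obtain ⟨Q, hQ⟩ := exists_symbol hn
      -- More than m commutators annihilate S, so the symbol at length n > m vanishes and the words
      -- can be shortened.
      have hQ0 : Q = 0 := symbol_unique hQ fun f => by
        rw [hS.symComm_pow_eq_zero f hmn, map_zero, smul_zero, LinearMap.zero_apply]
      rw [hQ0] at hQ
      exact ih (mem_wordSpan_of_symbol_zero hQ)
    · exact wordSpan_mono (by omega) hn

/-- Iterated commutators of S with f still map Λ_N to itself. Applied to 1 they give a multiple of
the symbol at the gradient of f, which is therefore symmetric. -/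
theorem symbol_mem_symmetric {k : ℂ} {n : ℕ} {S : Module.End ℂ (SymN N)} {Q : Poly N}
    (h : ((symIncl N).comp S, Q) ∈ symbolRel k N n) :
    Q ∈ MvPolynomial.symmetricSubalgebra (Fin N) ℂ := by
  refine symmetric_of_aeval_eulerOp fun f => ?_
  have h1 : ∀ n, ∃ S' : Module.End ℂ (SymN N),
      (symComm f ^ n) ((symIncl N).comp S) = (symIncl N).comp S' := by
    intro n
    induction n with
    | zero => exact ⟨S, rfl⟩
    | succ n ih =>
      obtain ⟨S', hS'⟩ := ih
      exact ⟨_, by rw [pow_succ', Module.End.mul_apply, hS', symComm_symIncl_comp]⟩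
  obtain ⟨S', hS'⟩ := h1 n
  have h2 := aeval_eulerOp_symbol h f
  rw [hS', LinearMap.comp_apply] at h2
  have h3 : MvPolynomial.aeval (fun i => eulerOp i f.1) Q =
      ((n.factorial : ℂ)⁻¹) • (S' 1).1 := by
    change _ = (n.factorial : ℂ)⁻¹ • symIncl N (S' 1)
    rw [h2, smul_smul, inv_mul_cancel₀ (Nat.cast_ne_zero.2 n.factorial_ne_zero),
      one_smul]
  rw [h3]
  exact Subalgebra.smul_mem _ (S' 1).2 _

/-- The order bound gives an expression by words of length at most r, and the r-fold commutators
identify its symbol. -/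
theorem symbol_freeIntegral {k : ℂ} {r : ℕ} (hr : 0 < r) {S : Module.End ℂ (SymN N)}
    (h : Induces (freeIntegral ℂ k r) S) :
    ((symIncl N).comp S, MvPolynomial.psum (Fin N) ℂ r) ∈ symbolRel k N r := by
  obtain ⟨S', hS', h'⟩ := exists_induces_freeIntegral k N r
  rw [← h.unique h'] at hS'
  obtain ⟨n, hn⟩ := exists_mem_wordSpan hS'
  obtain ⟨Q, hQ⟩ := exists_symbol ((isDiffOp_of_induces_freeIntegral h).mem_wordSpan hn)
  have := symbol_unique (Q' := MvPolynomial.psum (Fin N) ℂ r) hQ fun f => by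
    rw [symComm_pow_of_induces_freeIntegral hr h, MvPolynomial.psum, map_sum]
    simp
  rwa [← this]

/-! ### Lifting operators on `Λ_N` to polynomials in the stable generators -/

/-- Products of the stable generators. -/
def freeWord (k : ℂ) (l : List ℕ+) : Module.End ℂ Lam :=
  (l.map fun a : ℕ+ => freeIntegral ℂ k (a : ℕ)).prod

theorem freeWord_symbol (k : ℂ) (N : ℕ) (l : List ℕ+) : ∃ S : Module.End ℂ (SymN N),
    Induces (freeWord k l) S ∧
    ((symIncl N).comp S, (l.map fun a : ℕ+ => MvPolynomial.psum (Fin N) ℂ (a : ℕ)).prod) ∈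
      symbolRel k N (l.map fun a : ℕ+ => (a : ℕ)).sum := by
  induction l with
  | nil => exact ⟨1, fun f => rfl, Submodule.subset_span (Or.inl ⟨[], rfl, rfl⟩)⟩
  | cons a l ih =>
    obtain ⟨T, hT, hT'⟩ := ih
    obtain ⟨S, -, hS⟩ := exists_induces_freeIntegral k N a
    refine ⟨S * T, ?_, ?_⟩
    · rw [freeWord, List.map_cons, List.prod_cons]
      exact hS.mul hT
    · simp only [List.map_cons, List.prod_cons, List.sum_cons]
      exact symbolRel_comp (symbol_freeIntegral a.pos hS) hT'

/-- The span of the products of stable generators of total degree less than `n`. -/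
def freeSpan (k : ℂ) (n : ℕ) : Submodule ℂ (Module.End ℂ Lam) :=
  Submodule.span ℂ (freeWord k '' {l | (l.map fun a : ℕ+ => (a : ℕ)).sum < n})

theorem freeSpan_mono {k : ℂ} {m n : ℕ} (h : m ≤ n) : freeSpan k m ≤ freeSpan k n :=
  Submodule.span_mono (Set.image_mono fun _ hl => lt_of_lt_of_le hl h)

theorem freeSpan_le (k : ℂ) (n : ℕ) : freeSpan k n ≤
    Subalgebra.toSubmodule (Algebra.adjoin ℂ (Set.range (freeIntegral ℂ k))) := by
  refine Submodule.span_le.2 ?_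
  rintro _ ⟨l, -, rfl⟩
  refine Subalgebra.list_prod_mem _ fun x hx => ?_
  obtain ⟨a, -, rfl⟩ := List.mem_map.1 hx
  exact Algebra.subset_adjoin ⟨_, rfl⟩

theorem finite_lists_sum_lt (n : ℕ) :
    {l : List ℕ+ | (l.map fun a : ℕ+ => (a : ℕ)).sum < n}.Finite := by
  induction n with
  | zero => simp
  | succ n ih =>
    refine ((Set.finite_singleton []).union
      (((Set.finite_le_nat n).preimage PNat.coe_injective.injOn).image2 List.cons ih)).subset ?_
    rintro (_ | ⟨a, l⟩) hl
    · exact Or.inl rfl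
    · simp only [List.map_cons, List.sum_cons, Set.mem_ofPred_eq] at hl
      have := a.pos
      exact Or.inr ⟨a, show (a : ℕ) ≤ n by omega, l, show _ < n by omega, rfl⟩

theorem finiteDimensional_freeSpan (k : ℂ) (n : ℕ) : FiniteDimensional ℂ (freeSpan k n) :=
  FiniteDimensional.span_of_finite ℂ ((finite_lists_sum_lt n).image _)

theorem exists_freeSpan_symbol {k : ℂ} {n : ℕ} {Q : Poly N}
    (hQ : Q ∈ MvPolynomial.symmetricSubalgebra (Fin N) ℂ) (hn : Q.IsHomogeneous n) :
    ∃ a ∈ freeSpan k (n + 1), ∃ S : Module.End ℂ (SymN N), Induces a S ∧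
      ((symIncl N).comp S, Q) ∈ symbolRel k N n := by
  have h := homogeneous_mem_span_psum hQ hn
  clear hQ hn
  induction h using Submodule.span_induction with
  | mem Q h =>
    obtain ⟨l, rfl, rfl⟩ := h
    obtain ⟨S, hS⟩ := freeWord_symbol k N l
    exact ⟨_, Submodule.subset_span ⟨l, Nat.lt_succ_self _, rfl⟩, S, hS⟩
  | zero =>
    refine ⟨0, zero_mem _, 0, fun f => by simp, ?_⟩
    rw [LinearMap.comp_zero]
    exact zero_mem _
  | add P Q _ _ hP hQ =>
    obtain ⟨a, ha, S, hS, hS'⟩ := hP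
    obtain ⟨b, hb, T, hT, hT'⟩ := hQ
    refine ⟨a + b, add_mem ha hb, S + T, hS.add hT, ?_⟩
    have := add_mem hS' hT'
    rwa [Prod.mk_add_mk, ← LinearMap.comp_add] at this
  | smul c Q _ hQ =>
    obtain ⟨a, ha, S, hS, hS'⟩ := hQ
    refine ⟨c • a, Submodule.smul_mem _ c ha, c • S, hS.smul c, ?_⟩
    have := Submodule.smul_mem _ c hS'
    rwa [Prod.smul_mk, ← LinearMap.comp_smul] at this

/-- An operator on `Λ_N` which is a combination of words of length less than `n` is induced by a
polynomial of degree less than `n` in the stable generators. -/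
theorem exists_freeSpan_induces {k : ℂ} {n : ℕ} {S : Module.End ℂ (SymN N)}
    (hS : (symIncl N).comp S ∈ wordSpan k N n) : ∃ a ∈ freeSpan k n, Induces a S := by
  induction n generalizing S with
  | zero =>
    have h0 : (symIncl N).comp S = 0 := by
      have h1 : wordSpan k N 0 = ⊥ := by simp [wordSpan]
      rwa [h1, Submodule.mem_bot] at hS
    refine ⟨0, zero_mem _, fun f => Subtype.ext ?_⟩
    rw [LinearMap.zero_apply, map_zero]
    exact (LinearMap.congr_fun h0 (phi N f)).symm
  | succ n ih =>
    obtain ⟨Q, hQ⟩ := exists_symbol hS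
    obtain ⟨a, ha, T, hT, hT'⟩ := exists_freeSpan_symbol (k := k) (symbol_mem_symmetric hQ)
      (isHomogeneous_of_symbolRel hQ)
    -- Subtracting a lift with the same symbol leaves shorter words, to which the induction
    -- hypothesis applies.
    have h1 := sub_mem hQ hT'
    rw [Prod.mk_sub_mk, sub_self, ← LinearMap.comp_sub] at h1
    obtain ⟨b, hb, hb'⟩ := ih (mem_wordSpan_of_symbol_zero h1)
    refine ⟨b + a, add_mem (freeSpan_mono (Nat.le_succ n) hb) ha, ?_⟩
    have h2 : S - T + T = S := LinearMap.ext fun f => sub_add_cancel (S f) (T f)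
    have h3 := hb'.add hT
    rwa [h2] at h3

/-! ### Passage to the limit over N -/

theorem Induces.restrict {D : Module.End ℂ Lam} {S : (N : ℕ) → Module.End ℂ (SymN N)}
    (hS : ∀ N f, symRestrict N (S (N + 1) f) = S N (symRestrict N f)) {M N : ℕ} (h : M ≤ N)
    (hD : Induces D (S N)) : Induces D (S M) := by
  induction h with
  | refl => exact hD
  | step _ ih =>
    refine ih fun f => ?_
    rw [← symRestrict_phi, hD, hS, symRestrict_phi]

theorem eq_of_induces {D E : Module.End ℂ Lam} {S : (N : ℕ) → Module.End ℂ (SymN N)}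
    (hD : ∀ N, Induces D (S N)) (hE : ∀ N, Induces E (S N)) : D = E := by
  refine LinearMap.ext fun f => sub_eq_zero.1 (eq_zero_of_phi_eq_zero fun N => ?_)
  rw [map_sub, hD N f, hE N f, sub_self]

/-- The elements of a space of operators on `Λ` which induce zero on `Λ_N`. -/
def inducesZero (A : Submodule ℂ (Module.End ℂ Lam)) (N : ℕ) : Submodule ℂ A where
  carrier := {a | Induces a.1 (0 : Module.End ℂ (SymN N))}
  zero_mem' := fun f => map_zero (phi N)
  add_mem' := fun {a b} ha hb => by
    have : Induces (a.1 + b.1) (0 + 0 : Module.End ℂ (SymN N)) := Induces.add ha hb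
    rwa [add_zero] at this
  smul_mem' := fun c a ha => by
    have : Induces (c • a.1) (c • 0 : Module.End ℂ (SymN N)) := Induces.smul c ha
    rwa [smul_zero] at this

theorem inducesZero_antitone (A : Submodule ℂ (Module.End ℂ Lam)) : Antitone (inducesZero A) :=
  fun _ _ h _ ha => Induces.restrict (S := fun _ => 0) (fun N _ => map_zero (symRestrict N)) h ha

/-- Operators from a finite-dimensional space are determined by the induced operators on `Λ_N` for
large `N`. -/
theorem exists_inducesZero_eq_bot (A : Submodule ℂ (Module.End ℂ Lam)) [FiniteDimensional ℂ A] :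
    ∃ M, inducesZero A M = ⊥ := by
  have : IsArtinian ℂ A := isArtinian_of_fg_of_artinian' (R := ℂ) (M := A)
  obtain ⟨M, hM⟩ := IsArtinian.monotone_stabilizes
    (⟨fun n => OrderDual.toDual (inducesZero A n), fun m n h => inducesZero_antitone A h⟩ :
      ℕ →o (Submodule ℂ A)ᵒᵈ)
  refine ⟨M, (Submodule.eq_bot_iff _).2 fun a ha => Subtype.ext ?_⟩
  refine eq_of_induces (S := fun _ => 0) (fun N => ?_) fun N f => map_zero (phi N)
  -- Beyond M the chain is constant, so an element inducing zero on Λ_M does so on every Λ_N, and it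
  -- vanishes by joint injectivity of the φ_N.
  have h1 : inducesZero A M = inducesZero A (max M N) := hM _ (le_max_left _ _)
  rw [h1] at ha
  exact inducesZero_antitone A (le_max_right M N) ha

/-- Every element of the inverse limit is induced by a polynomial in the stable generators. -/
theorem exists_induces_of_mem_stableLimit {k : ℂ} {S : (N : ℕ) → Module.End ℂ (SymN N)}
    (hS : S ∈ stableLimit k) :
    ∃ a ∈ Algebra.adjoin ℂ (Set.range (freeIntegral ℂ k)), ∀ N, Induces a (S N) := by
  obtain ⟨hS, hS', m, hm⟩ := hS
  -- The uniform order m puts the lifts for all N into one finite-dimensional space.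
  have h : ∀ N, ∃ a ∈ freeSpan k (m + 1), Induces a (S N) := fun N => by
    obtain ⟨n, hn⟩ := exists_mem_wordSpan (hS N)
    exact exists_freeSpan_induces ((hm N).mem_wordSpan hn)
  choose a ha ha' using h
  have := finiteDimensional_freeSpan k (m + 1)
  obtain ⟨M, hM⟩ := exists_inducesZero_eq_bot (freeSpan k (m + 1))
  refine ⟨a M, freeSpan_le k _ (ha M), fun N => ?_⟩
  rcases le_total N M with h | h
  · exact (ha' M).restrict hS' h
  -- The lift of S_N also induces S_M, so the two lifts differ by an element inducing zero on Λ_M,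
  -- and the choice of M makes them equal.
  · have h1 : (⟨a N - a M, sub_mem (ha N) (ha M)⟩ : freeSpan k (m + 1)) ∈
        inducesZero (freeSpan k (m + 1)) M := by
      have h2 : S M - S M = 0 := LinearMap.ext fun f => sub_self (S M f)
      have h3 := ((ha' N).restrict hS' h).sub (ha' M)
      rwa [h2] at h3
    rw [hM, Submodule.mem_bot] at h1
    rw [← sub_eq_zero.1 (congrArg Subtype.val h1)]
    exact ha' N

theorem stableOps_eq (k : ℂ) :
    stableOps k = Algebra.adjoin ℂ (Set.range (freeIntegral ℂ k)) := by
  apply le_antisymm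
  · rintro D ⟨S, hS, hD⟩
    obtain ⟨a, ha, haS⟩ := exists_induces_of_mem_stableLimit hS
    rwa [eq_of_induces (fun N => hD N) haS]
  · refine Algebra.adjoin_le ?_
    rintro _ ⟨r, rfl⟩
    exact freeIntegral_mem_stableOps k r

/-- Each side determines the other: the φ_N are jointly injective and each is surjective. The
homomorphism laws for the chosen maps follow from this uniqueness. -/
theorem exists_algEquiv (k : ℂ) : ∃ Φ : stableLimit k ≃ₐ[ℂ] stableOps k,
    ∀ (S : stableLimit k) (N : ℕ) (f : Lam), phi N ((Φ S).1 f) = S.1 N (phi N f) := by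
  have h1 : ∀ S : stableLimit k, ∃ D : stableOps k, ∀ N, Induces D.1 (S.1 N) := fun S => by
    obtain ⟨a, ha, haS⟩ := exists_induces_of_mem_stableLimit S.2
    exact ⟨⟨a, S.1, S.2, fun N f => haS N f⟩, haS⟩
  have h2 : ∀ D : stableOps k, ∃ S : stableLimit k, ∀ N, Induces D.1 (S.1 N) := fun D => by
    obtain ⟨S, hS, hD⟩ := D.2
    exact ⟨⟨S, hS⟩, fun N f => hD N f⟩
  choose F hF using h1
  choose G hG using h2
  have hFu : ∀ (S : stableLimit k) (D : stableOps k), (∀ N, Induces D.1 (S.1 N)) → F S = D :=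
    fun S D h => Subtype.ext (eq_of_induces (hF S) h)
  refine ⟨AlgEquiv.mk ⟨F, G, fun S => ?_, fun D => hFu _ _ (hG D)⟩ (fun S T => ?_) (fun S T => ?_)
    fun c => ?_, fun S N f => hF S N f⟩
  · exact Subtype.ext (funext fun N => (hG (F S) N).unique (hF S N))
  · exact hFu _ _ fun N => (hF S N).mul (hF T N)
  · exact hFu _ _ fun N => (hF S N).add (hF T N)
  · exact hFu _ _ fun N => induces_algebraMap c

end StableGenerators

/-! ### The action of `ℂ[p₀] ⊗ D(k)` -/

section Action

variable {R : Type} [CommRing R] [Algebra ℂ R]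

theorem stableAction_tmul (k : ℂ) (p : R) (D : stableOps k) :
    stableAction k (p ⊗ₜ[ℂ] D) = p • extendOp (R := R) D.1 := by
  have h := Algebra.TensorProduct.lift_tmul (Algebra.ofId R (Module.End R (LamP R)))
    (extendOp.comp (stableOps k).val) (fun p _ => Algebra.commutes p _) p D
  exact h.trans (Algebra.smul_def p _).symm

theorem stableAction_injective (k : ℂ) :
    Function.Injective (stableAction (R := Polynomial ℂ) k) := by
  rw [injective_iff_map_eq_zero]
  intro t ht
  -- A tensor is a finite sum of p_0^n ⊗ d_n. On an element f of `Λ` the coefficient of p_0^n in the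
  -- action is d_n f, so every d_n can be read off.
  let e := TensorProduct.equivFinsuppOfBasisLeft (N := stableOps k) (Polynomial.basisMonomials ℂ)
  obtain ⟨d, rfl⟩ := e.symm.surjective t
  have hd : d = 0 := by
    refine Finsupp.ext fun n => Subtype.ext (LinearMap.ext fun f =>
      MvPolynomial.ext _ _ fun s => ?_)
    have h1 := congrArg (MvPolynomial.coeff s) (LinearMap.congr_fun ht (lamMap (Polynomial ℂ) f))
    rw [TensorProduct.equivFinsuppOfBasisLeft_symm_apply, Finsupp.sum, map_sum,
      LinearMap.sum_apply, MvPolynomial.coeff_sum] at h1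
    have h2 := congrArg (fun p => Polynomial.coeff p n) h1
    simp only [stableAction_tmul, LinearMap.smul_apply, extendOp_lamMap] at h2
    simp only [MvPolynomial.coeff_smul, Polynomial.coe_basisMonomials, lamMap, MvPolynomial.coeff_map, Polynomial.finsetSum_coeff,
      smul_eq_mul, Polynomial.algebraMap_eq, Polynomial.coeff_mul_C, Polynomial.coeff_monomial,
      LinearMap.zero_apply, MvPolynomial.coeff_zero, Polynomial.coeff_zero, ite_mul, one_mul,
      zero_mul, Finset.sum_ite_eq', Finsupp.mem_support_iff] at h2
    by_cases hn : d n = 0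
    · simp [hn]
    · simpa [hn] using h2
  rw [hd, map_zero]

/-- Both sides are generated over R by the extensions of the stable generators: the left by
`laurentAlgebra_eq`, the right by `stableOps_eq`. -/
theorem laurentAlgebra_eq_range (p₀ : R) (k : ℂ) :
    laurentAlgebra p₀ k = (stableAction (R := R) k).range := by
  rw [laurentAlgebra_eq]
  apply le_antisymm
  · refine Algebra.adjoin_le ?_
    rintro _ ⟨r, rfl⟩
    refine ⟨1 ⊗ₜ ⟨_, freeIntegral_mem_stableOps k r⟩, ?_⟩
    change stableAction k _ = _
    rw [stableAction_tmul, one_smul, extendOp_freeIntegral]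
  · have h : ∀ D ∈ stableOps k, extendOp (R := R) D ∈
        Algebra.adjoin R (Set.range (freeIntegral R k)) := by
      intro D hD
      rw [stableOps_eq] at hD
      induction hD using Algebra.adjoin_induction with
      | mem D h =>
        obtain ⟨r, rfl⟩ := h
        rw [extendOp_freeIntegral]
        exact Algebra.subset_adjoin ⟨r, rfl⟩
      | algebraMap c =>
        rw [AlgHom.commutes, IsScalarTower.algebraMap_apply ℂ R]
        exact Subalgebra.algebraMap_mem _ _
      | add D E _ _ hD hE => rw [map_add]; exact add_mem hD hE
      | mul D E _ _ hD hE => rw [map_mul]; exact mul_mem hD hE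
    rintro _ ⟨t, rfl⟩
    change stableAction k t ∈ _
    induction t using TensorProduct.induction_on with
    | zero => rw [map_zero]; exact zero_mem _
    | tmul p D => rw [stableAction_tmul]; exact Subalgebra.smul_mem _ (h D.1 D.2) p
    | add s t hs ht => rw [map_add]; exact add_mem hs ht

end Action

end CMS
end

theorem mainTheorem9 (k : ℂ) :
    (∃ Φ : CMS.stableLimit k ≃ₐ[ℂ] CMS.stableOps k,
      ∀ (S : CMS.stableLimit k) (N : ℕ) (f : CMS.Lam),
        CMS.phi N ((Φ S).1 f) = S.1 N (CMS.phi N f)) ∧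
    Function.Injective (CMS.stableAction (R := Polynomial ℂ) k) ∧
    CMS.laurentAlgebra (Polynomial.X : Polynomial ℂ) k =
      (CMS.stableAction (R := Polynomial ℂ) k).range :=
  ⟨CMS.exists_algEquiv k, CMS.stableAction_injective k, CMS.laurentAlgebra_eq_range _ k⟩
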